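/- Let $d\ge 1$ be an integer, let $a>0$, and let $\alpha\in L_1([0,\infty),r^{d-1}\,dr)\cap L_2([0,\infty),r^{d-1}\,dr)$ be real-valued and not almost everywhere zero. Say that $\alpha$ *generates a radial uniform averaging kernel on $\mathbb{R}^d$ for the translates of the ball of radius $a$* if, with $\omega=\{x\in\mathbb{R}^d:\|x\|_2\le a\}$ and $A(x,y)=\alpha(\|x-y\|_2)$, there is a real Hilbert space $\mathcal H$ which contains as a dense subspace a vector space $V$ of real functions on $\mathbb{R}^d$ (modulo equality almost everywhere, integrable over every ball $y+\omega$), such that for every $y\in\mathbb{R}^d$ the averaging functional $\lambda_y(f)=\frac1{|\omega|}\int_{y+\omega}f(x)\,dx$ on $V$ extends to a continuous linear functional on $\mathcal H$, and $A(\cdot,y)\in V$ represents it: $\lambda_y(f)=\langle f,A(\cdot,y)\rangle_{\mathcal H}$ for all $f\in\mathcal H$. (Thus $\mathcal H$ may be a complete space of functions, such as $L_2(\mathbb{R}^d)$, or the completion of a pre-Hilbert space of functions.) For real $\nu$ and $x>0$ let $J_\nu(x)=\sum_{k\ge0}\frac{(-1)^k}{k!\,\Gamma(k+\nu+1)}(x/2)^{2k+\nu}$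 be the Bessel function of the first kind, and let $0<j_1<j_2<\cdots$ be the positive zeros of $s\mapsto J_{d/2}(as)$. Then $\alpha$ generates a radial uniform averaging kernel on $\mathbb{R}^d$ for the translates of the ball of radius $a$ if and only if $\alpha$ is the inverse Hankel transform of order $\frac d2-1$ of a real function $\hat\alpha\in C_0([0,\infty))\cap L_2([0,\infty),s^{d-1}\,ds)$, i.e. $$\alpha(r)=\lim_{R\to\infty} r^{-\frac{d-2}{2}}\int_0^R\hat\alpha(s)\,s^{\frac d2}J_{\frac{d-2}{2}}(sr)\,ds\quad\text{in } L_2([0,\infty),r^{d-1}\,dr),$$ such that $$\hat\alpha(s)\ \begin{cases}\ge 0 & \text{if } s\in[0,j_1],\\ \le 0 & \text{if } s\in[j_{2k-1},j_{2k}],\ k\ge1,\\ \ge 0 & \text{if } s\in[j_{2k},j_{2k+1}],\ k\ge 1.\end{cases}$$ -/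

import Mathlib

open MeasureTheory Set Filter Topology
open scoped ENNReal

noncomputable section

/-- A real Hilbert space of functions on `E`, functions being identified when they agree almost
everywhere. The Hilbert space `H` is allowed to be the abstract completion of a pre-Hilbert space
of functions: the elements of the dense subspace `core` are functions, via the injective linear
map `toFun`. When `core = ⊤`, every element of `H` is a function (as for `L²(E)`). -/
structure FunctionHilbertSpace (E : Type) [MeasureSpace E] where
  H : Type
  [normed : NormedAddCommGroup H]
  [innerProduct : InnerProductSpace ℝ H]
  [complete : CompleteSpace H]
  core : Submodule ℝ H
  dense_core : Dense (core : Set H)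
  toFun : core →ₗ[ℝ] (E →ₘ[volume] ℝ)
  toFun_injective : Function.Injective toFun

attribute [instance] FunctionHilbertSpace.normed FunctionHilbertSpace.innerProduct
  FunctionHilbertSpace.complete

/-- `A` is the averaging kernel of the Hilbert space `X` of functions for the domains `ω τ`: the
averages over `ω τ` make sense for the functions in `X` and define continuous linear functionals
`lam τ` on `X`, and the function `A(·, τ)` is an element of `X` which represents `lam τ` in the
inner product of `X`. -/
def FunctionHilbertSpace.HasAveragingKernel {E T : Type} [MeasureSpace E]
    (X : FunctionHilbertSpace E) (ω : T → Set E) (A : E → T → ℝ) : Prop :=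
  (∀ (f : X.core) (τ : T), IntegrableOn (X.toFun f) (ω τ)) ∧
  ∃ lam : T → (X.H →L[ℝ] ℝ),
    (∀ (τ : T) (f : X.core), lam τ f = ⨍ x in ω τ, X.toFun f x) ∧
    ∀ τ : T, ∃ g : X.core, (X.toFun g =ᵐ[volume] fun x => A x τ) ∧
      ∀ f : X.H, lam τ f = inner ℝ f (g : X.H)

/-- `A` is an averaging kernel for the domains `ω τ`: it is the averaging kernel of some Hilbert
space of functions. -/
def IsAveragingKernel {E T : Type} [MeasureSpace E] (ω : T → Set E) (A : E → T → ℝ) : Prop :=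
  ∃ X : FunctionHilbertSpace E, X.HasAveragingKernel ω A

/-- A uniform averaging kernel: the domains are the translates `y + ω` of a single set `ω`. -/
def IsUniformAveragingKernel {d : ℕ} (ω : Set (EuclideanSpace ℝ (Fin d)))
    (A : EuclideanSpace ℝ (Fin d) → EuclideanSpace ℝ (Fin d) → ℝ) : Prop :=
  IsAveragingKernel (fun y => (fun x => y + x) '' ω) A

/-- The profile `α` generates the radial uniform averaging kernel `A(x, y) = α(‖x - y‖)` on `ℝ^d`
for the translates of the ball of radius `a`. -/
def GeneratesRadialAveragingKernel (d : ℕ) (a : ℝ) (α : ℝ → ℝ) : Prop :=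
  IsUniformAveragingKernel (d := d) (Metric.closedBall 0 a) (fun x y => α ‖x - y‖)

/-- The measure `r^(d-1) dr` on `[0, ∞)`. -/
def radialMeasure (d : ℕ) : Measure ℝ :=
  (volume.restrict (Ici (0 : ℝ))).withDensity (fun r => ENNReal.ofReal (r ^ (d - 1)))

/-- The Bessel function `J_ν(x)` of the first kind of real order `ν`, for `x > 0`. -/
def besselJ (ν x : ℝ) : ℝ :=
  ∑' k : ℕ, (-1) ^ k / (k.factorial * Real.Gamma (k + ν + 1)) * (x / 2) ^ (2 * (k : ℝ) + ν)

/-- `besselZero ν a k` is, for `k ≥ 1`, the `k`-th positive zero of `s ↦ J_ν(a s)`; the value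
for `k = 0` is `0`. -/
def besselZero (ν a : ℝ) : ℕ → ℝ
  | 0 => 0
  | k + 1 => sInf {s : ℝ | besselZero ν a k < s ∧ besselJ ν (a * s) = 0}

/-- The Hankel transform of order `d/2 - 1` of the restriction of `β` to `[0, R]`, namely
`r ↦ r^(-(d/2-1)) ∫_0^R β(s) s^(d/2) J_{d/2-1}(s r) ds` for `r > 0`. -/
def truncatedHankel (d : ℕ) (β : ℝ → ℝ) (R r : ℝ) : ℝ :=
  r ^ (-((d : ℝ) / 2 - 1)) *
    ∫ s in Ioc 0 R, β s * s ^ ((d : ℝ) / 2) * besselJ ((d : ℝ) / 2 - 1) (s * r)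

/-- `α` is the (inverse) Hankel transform of order `d/2 - 1` of `β` in the sense of Plancherel:
the transforms of the truncations of `β` to `[0, R]` converge to `α` in `L²([0, ∞), r^(d-1))`
as `R → ∞`. The transform is an involution, so it is its own inverse. -/
def IsInverseHankelTransform (d : ℕ) (β α : ℝ → ℝ) : Prop :=
  Tendsto (fun R : ℝ => eLpNorm (fun r => truncatedHankel d β R r - α r) 2 (radialMeasure d))
    atTop (𝓝 0)

/-- The sign pattern of `s ↦ J_{d/2}(a s)`: nonnegative up to the first positive zero, then
alternating in sign between consecutive zeros. -/
def HasBesselSignPattern (d : ℕ) (a : ℝ) (β : ℝ → ℝ) : Prop :=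
  (∀ s ∈ Icc 0 (besselZero ((d : ℝ) / 2) a 1), 0 ≤ β s) ∧
  ∀ k : ℕ, 1 ≤ k →
    (∀ s ∈ Icc (besselZero ((d : ℝ) / 2) a (2 * k - 1)) (besselZero ((d : ℝ) / 2) a (2 * k)),
      β s ≤ 0) ∧
    (∀ s ∈ Icc (besselZero ((d : ℝ) / 2) a (2 * k)) (besselZero ((d : ℝ) / 2) a (2 * k + 1)),
      0 ≤ β s)

end

open scoped FourierTransform

/-! ### The entire function underlying the Bessel functions -/

/-! Write `g(x) = α(‖x‖)` and let `χ` be the indicator of the ball. The representing property forces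
`⟨A(·,y), A(·,z)⟩` to be the average of `A(·,y)` over the ball about `z`, a positive multiple of the
correlation of `g` and `χ` at `z - y`. This is a continuous positive definite function of `z - y`
whose Fourier transform is a positive multiple of `ĝ χ̂`. Hence a kernel can exist only if `ĝ χ̂ ≥
0` (`cosTransform_mul_nonneg_of_isUniformAveragingKernel`).

Conversely, if `ĝ χ̂ ≥ 0`, the vectors `e^{-2πi⟨y,ξ⟩} √(c ĝ χ̂)` in `L²`, with `c` the inverse
volume of the ball, have exactly the required inner products. Since `χ̂ ≠ 0` almost everywhere,
these vectors satisfy the same linear relations as the translates `g(· - y)`. The closure of their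
span is therefore a completion of a space of functions (`isAveragingKernel_of_featureMap`,
`isUniformAveragingKernel_of_cosTransform_mul_nonneg`).

It remains to translate `ĝ χ̂ ≥ 0` into the sign pattern. Integration over spheres gives `χ̂(ξ)` as
a positive multiple of `besselU (d/2) (2πa‖ξ‖)`, where `besselU ν x` is a positive multiple of
`x^{-ν} J_ν(x)` (`integral_ball_cos`). Its positive zeros are simple and unbounded, so it changes
sign exactly at the `j_k` (`besselU_sign`), and for a continuous factor the product condition is the
stated alternation (`hasBesselSignPattern_iff`).

The Hankel transform is the radial Fourier transform. With frequencies normalized by `e^{2πi⟨x,ξ⟩}`,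
the profile `β` corresponds to `(2π)^{d/2} β(2π‖ξ‖)`, and Plancherel identifies the `L²` limit in
the statement with `radialLift d β = ĝ` (`isInverseHankelTransform_iff`). Continuity and decay of
`β` come from `g ∈ L¹`, square integrability from `g ∈ L²`. -/

/-- The coefficients `(-1)^k / (k! Γ(k + ν + 1))`. -/
noncomputable def besselCoeff (ν : ℝ) (k : ℕ) : ℝ :=
  (-1) ^ k / (k.factorial * Real.Gamma (k + ν + 1))

/-- The entire function `Φ_ν` for which `J_ν(x) = (x / 2)^ν Φ_ν(x² / 4)`. -/
noncomputable def besselPhi (ν t : ℝ) : ℝ := ∑' k : ℕ, besselCoeff ν k * t ^ k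

/-- The Gamma values may drop in the first step, since `ν + 1` may be below 1. Every later step
multiplies by a factor at least 1, so the first two reciprocals bound all of them. -/
lemma inv_Gamma_bounded {ν : ℝ} (hν : -1 < ν) :
    ∃ C : ℝ, 0 < C ∧ ∀ k : ℕ, (Real.Gamma (k + ν + 1))⁻¹ ≤ C := by
  have h0 : 0 < Real.Gamma (ν + 1) := Real.Gamma_pos_of_pos (by linarith)
  have h1 : 0 < Real.Gamma (ν + 1 + 1) := Real.Gamma_pos_of_pos (by linarith)
  have key : ∀ k : ℕ, Real.Gamma (ν + 1 + 1) ≤ Real.Gamma ((k + 1 : ℕ) + ν + 1) := by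
    intro k
    induction k with
    | zero => exact le_of_eq (by congr 1; push_cast; ring)
    | succ k ih =>
      have hk : (0 : ℝ) ≤ k := k.cast_nonneg
      have hpos : 0 < ((k + 1 : ℕ) : ℝ) + ν + 1 := by push_cast; linarith
      have : (((k + 1 + 1 : ℕ) : ℝ) + ν + 1) = (((k + 1 : ℕ) : ℝ) + ν + 1) + 1 := by
        push_cast; ring
      rw [this, Real.Gamma_add_one hpos.ne']
      refine ih.trans (le_mul_of_one_le_left (Real.Gamma_pos_of_pos hpos).le ?_)
      push_cast; linarith
  refine ⟨(Real.Gamma (ν + 1))⁻¹ + (Real.Gamma (ν + 1 + 1))⁻¹, by positivity, fun k => ?_⟩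
  cases k with
  | zero => simp [h1.le]
  | succ k =>
    have := inv_anti₀ h1 (key k)
    have h2 : 0 ≤ (Real.Gamma (ν + 1))⁻¹ := by positivity
    linarith

lemma abs_besselCoeff_le {ν : ℝ} (hν : -1 < ν) :
    ∃ C : ℝ, 0 < C ∧ ∀ k : ℕ, |besselCoeff ν k| ≤ C / k.factorial := by
  obtain ⟨C, hC, h⟩ := inv_Gamma_bounded hν
  refine ⟨C, hC, fun k => ?_⟩
  have hg : 0 < Real.Gamma (k + ν + 1) :=
    Real.Gamma_pos_of_pos (by have : (0 : ℝ) ≤ k := k.cast_nonneg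
                              linarith)
  have hf : (0 : ℝ) < k.factorial := by positivity
  rw [besselCoeff, abs_div, abs_pow, abs_neg, abs_one, one_pow, abs_of_pos (by positivity),
    one_div, mul_inv, div_eq_inv_mul]
  exact mul_le_mul_of_nonneg_left (h k) (by positivity)

lemma summable_besselCoeff {ν : ℝ} (hν : -1 < ν) (t : ℝ) :
    Summable fun k => besselCoeff ν k * t ^ k := by
  obtain ⟨C, hC, h⟩ := abs_besselCoeff_le hν
  refine Summable.of_norm_bounded ((Real.summable_pow_div_factorial |t|).mul_left C) fun k => ?_
  rw [Real.norm_eq_abs, abs_mul, abs_pow]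
  calc |besselCoeff ν k| * |t| ^ k ≤ C / k.factorial * |t| ^ k := by gcongr; exact h k
    _ = _ := by ring

lemma besselCoeff_succ (ν : ℝ) (k : ℕ) :
    besselCoeff ν (k + 1) * (k + 1 : ℕ) = - besselCoeff (ν + 1) k := by
  have hf : (k.factorial : ℝ) ≠ 0 := by positivity
  have hk : (k : ℝ) + 1 ≠ 0 := by positivity
  have : ((k + 1 : ℕ) : ℝ) + ν + 1 = k + (ν + 1) + 1 := by push_cast; ring
  rw [besselCoeff, besselCoeff, this, Nat.factorial_succ]
  push_cast
  -- Here `ν` is arbitrary. At a pole `Real.Gamma` takes the value 0, and both sides vanish.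
  by_cases hg : Real.Gamma (k + (ν + 1) + 1) = 0
  · simp [hg]
  · field_simp
    ring

lemma hasDerivAt_besselPhi {ν : ℝ} (hν : -1 < ν) (t : ℝ) :
    HasDerivAt (besselPhi ν) (-besselPhi (ν + 1) t) t := by
  obtain ⟨C, hC, h⟩ := abs_besselCoeff_le hν
  set R : ℝ := |t| + 1
  have hR : 0 ≤ R := by positivity
  have hder : HasDerivAt (besselPhi ν)
      (∑' k : ℕ, besselCoeff ν k * ((k : ℝ) * t ^ (k - 1))) t := by
    refine hasDerivAt_tsum_of_isPreconnected (u := fun k : ℕ => C / k.factorial * (k * R ^ (k - 1)))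
      (g := fun k s => besselCoeff ν k * s ^ k)
      (g' := fun k s => besselCoeff ν k * ((k : ℝ) * s ^ (k - 1)))
      (t := Ioo (-R) R) (y₀ := 0) ?_ isOpen_Ioo isPreconnected_Ioo ?_ ?_ ?_
      (summable_besselCoeff hν 0) ?_
    · rw [← summable_nat_add_iff 1]
      refine ((Real.summable_pow_div_factorial R).mul_left C).congr fun k => ?_
      have hf : (k.factorial : ℝ) ≠ 0 := by positivity
      have hk : (k : ℝ) + 1 ≠ 0 := by positivity
      rw [Nat.factorial_succ]
      push_cast
      field_simp
    · intro k s _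
      exact (hasDerivAt_pow k s).const_mul _
    · intro k s hs
      have hs' : |s| ≤ R := abs_le.2 ⟨hs.1.le, hs.2.le⟩
      rw [Real.norm_eq_abs, abs_mul, abs_mul, abs_pow, Nat.abs_cast]
      gcongr
      exact h k
    · exact ⟨by linarith [abs_nonneg t], by linarith [abs_nonneg t]⟩
    · exact ⟨by linarith [neg_abs_le t], by linarith [le_abs_self t]⟩
  convert hder using 1
  rw [besselPhi, ← tsum_neg]
  have hs : Summable fun k : ℕ => besselCoeff ν k * ((k : ℝ) * t ^ (k - 1)) := by
    rw [← summable_nat_add_iff 1]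
    refine ((summable_besselCoeff (by linarith : -1 < ν + 1) t).neg).congr fun k => ?_
    rw [← neg_mul, ← besselCoeff_succ, Nat.add_sub_cancel]
    ring
  rw [hs.tsum_eq_zero_add]
  simp only [Nat.cast_zero, zero_mul, mul_zero, zero_add]
  refine tsum_congr fun k => ?_
  rw [← neg_mul, ← besselCoeff_succ, Nat.add_sub_cancel]
  ring

lemma besselPhi_zero_pos {ν : ℝ} (hν : -1 < ν) : 0 < besselPhi ν 0 := by
  rw [besselPhi, tsum_eq_single 0 (by intro k hk; simp [hk])]
  simpa [besselCoeff] using Real.Gamma_pos_of_pos (by linarith : 0 < ν + 1)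

/-- Coefficientwise, `c_ν(k) = (k + ν + 1) c_{ν+1}(k)`. The factor `k` produces `t Φ'_{ν+1}(t) = -t
Φ_{ν+2}(t)`. This is the three-term recurrence of the Bessel functions. -/
lemma besselPhi_recurrence {ν : ℝ} (hν : -1 < ν) (t : ℝ) :
    besselPhi ν t = (ν + 1) * besselPhi (ν + 1) t - t * besselPhi (ν + 2) t := by
  have h1 := summable_besselCoeff (by linarith : -1 < ν + 1) t
  have h2 := summable_besselCoeff (by linarith : -1 < ν + 2) t
  have h2' : Summable fun k : ℕ => (k : ℝ) * besselCoeff (ν + 1) k * t ^ k := by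
    rw [← summable_nat_add_iff 1]
    refine (h2.mul_left (-t)).congr fun k => ?_
    have := besselCoeff_succ (ν + 1) k
    rw [mul_comm ((k + 1 : ℕ) : ℝ), this, show ν + 1 + 1 = ν + 2 by ring]
    ring
  have e2 : ∑' k : ℕ, (k : ℝ) * besselCoeff (ν + 1) k * t ^ k = -(t * besselPhi (ν + 2) t) := by
    rw [h2'.tsum_eq_zero_add, besselPhi, ← neg_mul, ← tsum_mul_left]
    simp only [Nat.cast_zero, zero_mul, zero_add]
    refine tsum_congr fun k => ?_
    have := besselCoeff_succ (ν + 1) k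
    rw [mul_comm ((k + 1 : ℕ) : ℝ), this, show ν + 1 + 1 = ν + 2 by ring]
    ring
  rw [sub_eq_add_neg, ← e2, besselPhi, besselPhi, ← tsum_mul_left,
    ← (h1.mul_left (ν + 1)).tsum_add h2']
  refine tsum_congr fun k => ?_
  have hk : (0 : ℝ) ≤ k := k.cast_nonneg
  have hpos : 0 < (k : ℝ) + ν + 1 := by linarith
  have hg := (Real.Gamma_pos_of_pos hpos).ne'
  have hf : (k.factorial : ℝ) ≠ 0 := by positivity
  have : (k : ℝ) + (ν + 1) + 1 = (k + ν + 1) + 1 := by ring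
  rw [besselCoeff, besselCoeff, this, Real.Gamma_add_one hpos.ne']
  field_simp
  ring

lemma besselJ_eq {ν x : ℝ} (hx : 0 < x) :
    besselJ ν x = (x / 2) ^ ν * besselPhi ν (x ^ 2 / 4) := by
  rw [besselJ, besselPhi, ← tsum_mul_left]
  refine tsum_congr fun k => ?_
  rw [Real.rpow_add (by positivity), besselCoeff,
    show (2 * (k : ℝ)) = ((2 * k : ℕ) : ℝ) by push_cast; ring, Real.rpow_natCast, pow_mul]
  ring

/-! ### Zeros of the normalized Bessel function -/

/-- The normalized Bessel function `x ↦ Φ_ν(x² / 4)`, a positive multiple of `x^(-ν) J_ν(x)`. -/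
noncomputable def besselU (ν x : ℝ) : ℝ := besselPhi ν (x ^ 2 / 4)

lemma besselJ_eq_zero_iff {ν x : ℝ} (hx : 0 < x) : besselJ ν x = 0 ↔ besselU ν x = 0 := by
  rw [besselJ_eq hx, mul_eq_zero, besselU, or_iff_right (Real.rpow_pos_of_pos (by positivity) _).ne']

lemma hasDerivAt_besselU {ν : ℝ} (hν : -1 < ν) (x : ℝ) :
    HasDerivAt (besselU ν) (-(x / 2) * besselU (ν + 1) x) x := by
  have h1 : HasDerivAt (fun x : ℝ => x ^ 2 / 4) (x / 2) x := by
    refine ((hasDerivAt_pow 2 x).div_const 4).congr_deriv ?_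
    push_cast; ring
  refine ((hasDerivAt_besselPhi hν (x ^ 2 / 4)).comp x h1).congr_deriv ?_
  rw [besselU]; ring

lemma continuous_besselU {ν : ℝ} (hν : -1 < ν) : Continuous (besselU ν) :=
  continuous_iff_continuousAt.2 fun t => (hasDerivAt_besselU hν t).continuousAt

lemma besselU_zero_pos {ν : ℝ} (hν : -1 < ν) : 0 < besselU ν 0 := by
  simpa [besselU] using besselPhi_zero_pos hν

/-- The derivative of `besselU ν`. -/
noncomputable def besselU' (ν x : ℝ) : ℝ := -(x / 2) * besselU (ν + 1) x

/-- Bessel's differential equation. -/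
lemma hasDerivAt_besselU' {ν : ℝ} (hν : -1 < ν) {x : ℝ} (hx : 0 < x) :
    HasDerivAt (besselU' ν) (-((2 * ν + 1) / x) * besselU' ν x - besselU ν x) x := by
  have h := ((hasDerivAt_id x).div_const 2).neg.mul
    (hasDerivAt_besselU (by linarith : -1 < ν + 1) x)
  refine h.congr_deriv ?_
  have := besselPhi_recurrence hν (x ^ 2 / 4)
  simp only [besselU', besselU, id, Pi.neg_apply]
  rw [this, show ν + 1 + 1 = ν + 2 by ring]
  field_simp
  ring

/-- Zeros are simple by an energy argument. By Bessel's equation `y^p (u² + u'²)` with `p = 2(2ν+1)`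
has derivative `p y^{p-1} u² ≥ 0`. If it vanished at `x` it would vanish on all of `(0, x)`,
contradicting `u(0) > 0`. -/
lemma besselU'_ne_zero {ν : ℝ} (hν : -1 / 2 ≤ ν) {x : ℝ} (hx : 0 < x) (h0 : besselU ν x = 0) :
    besselU' ν x ≠ 0 := by
  intro h1
  have hν' : -1 < ν := by linarith
  set p : ℝ := 2 * (2 * ν + 1)
  set F : ℝ → ℝ := fun y => y ^ p * (besselU ν y ^ 2 + besselU' ν y ^ 2)
  have hder : ∀ y, 0 < y → HasDerivAt F (p * y ^ (p - 1) * besselU ν y ^ 2) y := by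
    intro y hy
    have hu : HasDerivAt (besselU ν) (besselU' ν y) y := hasDerivAt_besselU hν' y
    have h := (Real.hasDerivAt_rpow_const (p := p) (Or.inl hy.ne')).mul
      ((hu.pow 2).add ((hasDerivAt_besselU' hν' hy).pow 2))
    refine h.congr_deriv ?_
    simp only [Pi.add_apply, Pi.pow_apply]
    have : y ^ p = y ^ (p - 1) * y := by
      rw [← Real.rpow_add_one hy.ne']; congr 1; ring
    rw [this]
    simp only [p]
    field_simp
    ring
  have hmono : MonotoneOn F (Ioi 0) := by
    refine monotoneOn_of_deriv_nonneg (convex_Ioi 0)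
      (fun y hy => (hder y hy).continuousAt.continuousWithinAt) ?_ ?_
    · intro y hy
      rw [interior_Ioi] at hy
      exact (hder y hy).differentiableAt.differentiableWithinAt
    · intro y hy
      rw [interior_Ioi] at hy
      rw [(hder y hy).deriv]
      have : 0 ≤ p := by simp only [p]; linarith
      have := Real.rpow_nonneg (le_of_lt hy) (p - 1)
      positivity
  have hzero : ∀ y ∈ Ioo 0 x, besselU ν y = 0 := by
    intro y hy
    have h2 : F y ≤ F x := hmono hy.1 hx hy.2.le
    have h3 : F x = 0 := by simp [F, h0, h1]
    have hp := Real.rpow_pos_of_pos hy.1 p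
    have h4 : besselU ν y ^ 2 + besselU' ν y ^ 2 ≤ 0 := by
      by_contra hcon
      push Not at hcon
      have : 0 < F y := mul_pos hp hcon
      linarith
    nlinarith [sq_nonneg (besselU ν y), sq_nonneg (besselU' ν y)]
  have hpos := besselU_zero_pos hν'
  have hev : ∀ᶠ y in 𝓝[>] (0 : ℝ), 0 < besselU ν y :=
    ((continuous_besselU hν').continuousAt.eventually (lt_mem_nhds hpos)).filter_mono
      nhdsWithin_le_nhds
  obtain ⟨y, hy1, hy2⟩ := (hev.and (Ioo_mem_nhdsGT hx)).exists
  exact hy1.ne' (hzero y hy2)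

/-- Sturm comparison. The function `w = x^{ν+1/2} u` satisfies `w'' = -(1 - (ν² - 1/4)/x²) w`, which
for large `x` oscillates faster than `v'' = -v/4`. A `w` of constant sign on `[Y, ∞)` would make the
Wronskian of `w` and `v` decrease over a half period of `v`, while its end values have signs
requiring an increase. -/
lemma exists_besselU_eq_zero_gt {ν : ℝ} (hν : -1 / 2 ≤ ν) (X : ℝ) :
    ∃ x, X < x ∧ besselU ν x = 0 := by
  by_contra! hcon
  have hν' : -1 < ν := by linarith
  -- Beyond `2|ν|` the factor `ν² - 1/4 - (3/4)x²` in the derivative of the Wronskian is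
  -- nonpositive.
  set Y : ℝ := max X (2 * |ν| + 2) + 1
  have hXY : X < Y := by have := le_max_left X (2 * |ν| + 2); simp only [Y]; linarith
  have hνY : 2 * |ν| + 2 < Y := by have := le_max_right X (2 * |ν| + 2); simp only [Y]; linarith
  have hY : 0 < Y := by linarith [abs_nonneg ν]
  have hne : ∀ x ∈ Ici Y, besselU ν x ≠ 0 := fun x hx => hcon x (hXY.trans_le hx)
  obtain ⟨σ, hσ⟩ : ∃ σ : ℝ, ∀ x ∈ Ici Y, 0 < σ * besselU ν x := by
    rcases lt_or_gt_of_ne (hne Y self_mem_Ici) with h | h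
    · refine ⟨-1, fun x hx => ?_⟩
      by_contra hx'
      have hx'' : 0 ≤ besselU ν x := by linarith
      obtain ⟨c, hc, hc'⟩ := isPreconnected_Ici.intermediate_value (s := Ici Y)
        (f := besselU ν) self_mem_Ici hx (continuous_besselU hν').continuousOn ⟨h.le, hx''⟩
      exact hne c hc hc'
    · refine ⟨1, fun x hx => ?_⟩
      by_contra hx'
      have hx'' : besselU ν x ≤ 0 := by linarith
      obtain ⟨c, hc, hc'⟩ := isPreconnected_Ici.intermediate_value (s := Ici Y)
        (f := besselU ν) hx self_mem_Ici (continuous_besselU hν').continuousOn ⟨hx'', h.le⟩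
      exact hne c hc hc'
  set q : ℝ := ν + 1 / 2
  -- `F = w' v - w v'` with `w = σ x^q u`, `v = sin ((x - Y) / 2)`
  set F : ℝ → ℝ := fun x =>
    (q * x ^ (q - 1) * (σ * besselU ν x) + x ^ q * (σ * besselU' ν x)) * Real.sin ((x - Y) / 2)
      - x ^ q * (σ * besselU ν x) * (Real.cos ((x - Y) / 2) / 2)
  have hder : ∀ x, 0 < x → HasDerivAt F
      (x ^ (q - 2) * (σ * besselU ν x) * Real.sin ((x - Y) / 2) *
        (ν ^ 2 - 1 / 4 - 3 / 4 * x ^ 2)) x := by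
    intro x hx
    have hu : HasDerivAt (besselU ν) (besselU' ν x) x := hasDerivAt_besselU hν' x
    have hu' := hasDerivAt_besselU' hν' hx
    have hs : HasDerivAt (fun x => (x - Y) / 2) (1 / 2) x := ((hasDerivAt_id x).sub_const Y).div_const 2
    have hp (r : ℝ) := Real.hasDerivAt_rpow_const (x := x) (p := r) (Or.inl hx.ne')
    have h := (((((hp (q - 1)).const_mul q).mul (hu.const_mul σ)).add
      ((hp q).mul (hu'.const_mul σ))).mul hs.sin).sub
      (((hp q).mul (hu.const_mul σ)).mul (hs.cos.div_const 2))
    refine h.congr_deriv ?_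
    have e1 : x ^ (q - 1) = x ^ (q - 2) * x := by
      rw [← Real.rpow_add_one hx.ne']; congr 1; ring
    have e2 : x ^ q = x ^ (q - 2) * x ^ 2 := by
      rw [← Real.rpow_natCast, ← Real.rpow_add hx]; congr 1; push_cast; ring
    have e3 : x ^ (q - 1 - 1) = x ^ (q - 2) := by congr 1; ring
    simp only [Pi.add_apply, Pi.mul_apply]
    rw [e3, e1, e2]
    simp only [q]
    field_simp
    ring
  have hanti : AntitoneOn F (Icc Y (Y + 2 * Real.pi)) := by
    refine antitoneOn_of_deriv_nonpos (convex_Icc _ _)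
      (fun y hy => (hder y (hY.trans_le hy.1)).continuousAt.continuousWithinAt) ?_ ?_
    · intro y hy
      rw [interior_Icc] at hy
      exact (hder y (hY.trans hy.1)).differentiableAt.differentiableWithinAt
    · intro y hy
      rw [interior_Icc] at hy
      rw [(hder y (hY.trans hy.1)).deriv]
      have h1 : 0 < y ^ (q - 2) := Real.rpow_pos_of_pos (hY.trans hy.1) _
      have h2 := hσ y hy.1.le
      have h3 : 0 ≤ Real.sin ((y - Y) / 2) :=
        Real.sin_nonneg_of_nonneg_of_le_pi (by linarith [hy.1]) (by linarith [hy.2])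
      have h4 : ν ^ 2 - 1 / 4 - 3 / 4 * y ^ 2 ≤ 0 := by
        have : 2 * |ν| ≤ y := by linarith [hy.1]
        have h5 : ν ^ 2 = |ν| ^ 2 := (sq_abs ν).symm
        rw [h5]
        nlinarith [abs_nonneg ν]
      exact mul_nonpos_of_nonneg_of_nonpos (by positivity) h4
  have hle := hanti (left_mem_Icc.2 (by linarith [Real.pi_pos]))
    (right_mem_Icc.2 (by linarith [Real.pi_pos])) (by linarith [Real.pi_pos])
  have hY2 : 0 < Y + 2 * Real.pi := by linarith [Real.pi_pos]
  have e1 : (Y + 2 * Real.pi - Y) / 2 = Real.pi := by ring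
  simp only [F, e1, sub_self, zero_div, Real.sin_zero, Real.cos_zero, Real.sin_pi, Real.cos_pi,
    mul_zero, zero_sub] at hle
  have p1 := mul_pos (Real.rpow_pos_of_pos hY q) (hσ Y self_mem_Ici)
  have p2 := mul_pos (Real.rpow_pos_of_pos hY2 q)
    (hσ (Y + 2 * Real.pi) (by simp [Real.pi_pos.le]))
  linarith

section Zeros

variable {ν a : ℝ}

lemma besselU_smul_eventually_ne (hν : -1 / 2 ≤ ν) (ha : 0 < a) {c : ℝ} (hc : 0 < c) :
    ∀ᶠ s in 𝓝[≠] c, besselU ν (a * s) ≠ 0 := by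
  by_cases h : besselU ν (a * c) = 0
  · have hd : HasDerivAt (fun s => besselU ν (a * s)) (besselU' ν (a * c) * a) c :=
      (hasDerivAt_besselU (by linarith) (a * c)).comp c
        (((hasDerivAt_id c).const_mul a).congr_deriv (by simp))
    exact hd.eventually_ne (mul_ne_zero (besselU'_ne_zero hν (by positivity) h) ha.ne')
  · have : Continuous fun s => besselU ν (a * s) :=
      (continuous_besselU (by linarith)).comp (continuous_const_mul a)
    exact (this.continuousAt.eventually_ne h).filter_mono nhdsWithin_le_nhds

/-- The infimum defining the next zero is attained: zeros are isolated and 0 is not one, so the set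
of later zeros stays away from `z` and is closed. It is nonempty because zeros are unbounded. -/
lemma besselZero_step (hν : -1 / 2 ≤ ν) (ha : 0 < a) (k : ℕ) (hk : 0 ≤ besselZero ν a k) :
    besselZero ν a k < besselZero ν a (k + 1) ∧
    besselU ν (a * besselZero ν a (k + 1)) = 0 ∧
    ∀ s ∈ Ioo (besselZero ν a k) (besselZero ν a (k + 1)), besselU ν (a * s) ≠ 0 := by
  set z := besselZero ν a k
  have hcont : Continuous fun s => besselU ν (a * s) :=
    (continuous_besselU (by linarith)).comp (continuous_const_mul a)
  have hS : {s : ℝ | z < s ∧ besselJ ν (a * s) = 0} = {s | z < s ∧ besselU ν (a * s) = 0} := by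
    ext s
    refine and_congr_right fun hs => besselJ_eq_zero_iff ?_
    exact mul_pos ha (hk.trans_lt hs)
  have hz : besselZero ν a (k + 1) = sInf {s | z < s ∧ besselU ν (a * s) = 0} := by
    rw [← hS]; rfl
  have hright : ∀ᶠ s in 𝓝[>] z, besselU ν (a * s) ≠ 0 := by
    rcases hk.eq_or_lt with h | h
    · rw [← h]
      have h0 : besselU ν (a * 0) ≠ 0 := by
        rw [mul_zero]; exact (besselU_zero_pos (by linarith)).ne'
      exact (hcont.continuousAt.eventually_ne h0).filter_mono nhdsWithin_le_nhds
    · exact (besselU_smul_eventually_ne hν ha h).filter_mono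
        (nhdsWithin_mono _ fun x hx => (ne_of_gt hx : x ≠ z))
  obtain ⟨y, hy, hy'⟩ := (mem_nhdsGT_iff_exists_Ioo_subset).1 hright
  have hS2 : {s | z < s ∧ besselU ν (a * s) = 0} = Ici y ∩ {s | besselU ν (a * s) = 0} := by
    ext s
    constructor
    · rintro ⟨h1, h2⟩
      refine ⟨?_, h2⟩
      by_contra h3
      exact hy' ⟨h1, not_le.1 h3⟩ h2
    · rintro ⟨h1, h2⟩
      exact ⟨lt_of_lt_of_le hy h1, h2⟩
  have hclosed : IsClosed {s | z < s ∧ besselU ν (a * s) = 0} := by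
    rw [hS2]; exact isClosed_Ici.inter (isClosed_eq hcont continuous_const)
  have hne : {s | z < s ∧ besselU ν (a * s) = 0}.Nonempty := by
    obtain ⟨x, hx, hx0⟩ := exists_besselU_eq_zero_gt hν (a * z)
    refine ⟨x / a, (lt_div_iff₀' ha).2 hx, ?_⟩
    rwa [mul_div_cancel₀ _ ha.ne']
  have hbdd : BddBelow {s | z < s ∧ besselU ν (a * s) = 0} := ⟨z, fun s hs => hs.1.le⟩
  have hmem := hclosed.csInf_mem hne hbdd
  rw [← hz] at hmem
  refine ⟨hmem.1, hmem.2, fun s hs h => ?_⟩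
  have := csInf_le hbdd (show s ∈ {s | z < s ∧ besselU ν (a * s) = 0} from ⟨hs.1, h⟩)
  rw [← hz] at this
  exact absurd hs.2 (not_lt.2 this)

lemma besselZero_nonneg (hν : -1 / 2 ≤ ν) (ha : 0 < a) (k : ℕ) : 0 ≤ besselZero ν a k := by
  induction k with
  | zero => simp [besselZero]
  | succ k ih => exact ih.trans (besselZero_step hν ha k ih).1.le

lemma besselZero_strictMono (hν : -1 / 2 ≤ ν) (ha : 0 < a) : StrictMono (besselZero ν a) :=
  strictMono_nat_of_lt_succ fun k => (besselZero_step hν ha k (besselZero_nonneg hν ha k)).1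

lemma besselZero_pos (hν : -1 / 2 ≤ ν) (ha : 0 < a) (k : ℕ) : 0 < besselZero ν a (k + 1) :=
  (besselZero_nonneg hν ha 0).trans_lt (besselZero_strictMono hν ha k.succ_pos)

/-- A finite limit would be an accumulation point of zeros. -/
lemma tendsto_besselZero (hν : -1 / 2 ≤ ν) (ha : 0 < a) :
    Tendsto (besselZero ν a) atTop atTop := by
  have hmono := besselZero_strictMono hν ha
  rcases tendsto_atTop_of_monotone hmono.monotone with h | ⟨l, hl⟩
  · exact h
  exfalso
  have hlt : ∀ k, besselZero ν a k < l := fun k =>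
    (hmono k.lt_succ_self).trans_le (hmono.monotone.ge_of_tendsto hl _)
  have hl0 : 0 < l := (besselZero_pos hν ha 0).trans (hlt 1)
  have h1 : Tendsto (besselZero ν a) atTop (𝓝[≠] l) :=
    tendsto_nhdsWithin_iff.2 ⟨hl, Eventually.of_forall fun k => (hlt k).ne⟩
  obtain ⟨k, hk, hk1⟩ := ((h1.eventually (besselU_smul_eventually_ne hν ha hl0)).and
    (eventually_ge_atTop 1)).exists
  obtain ⟨m, rfl⟩ := Nat.exists_eq_add_of_le' hk1
  exact hk (besselZero_step hν ha m (besselZero_nonneg hν ha m)).2.1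

lemma exists_besselZero_lt_le (hν : -1 / 2 ≤ ν) (ha : 0 < a) {s : ℝ} (hs : 0 < s) :
    ∃ k, besselZero ν a k < s ∧ s ≤ besselZero ν a (k + 1) := by
  classical
  have hex : ∃ k, s ≤ besselZero ν a k :=
    ((tendsto_besselZero hν ha).eventually (eventually_ge_atTop s)).exists
  have hpos : Nat.find hex ≠ 0 := by
    intro h
    have := Nat.find_spec hex
    rw [h] at this
    simp only [besselZero] at this
    linarith
  obtain ⟨m, hm⟩ := Nat.exists_eq_succ_of_ne_zero hpos
  refine ⟨m, not_le.1 (Nat.find_min hex (by omega)), ?_⟩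
  have := Nat.find_spec hex
  rwa [hm] at this

lemma pos_on_Ioo_of_ne_zero {f : ℝ → ℝ} (hf : Continuous f) {b c : ℝ}
    (hne : ∀ s ∈ Ioo b c, f s ≠ 0) {s₀ : ℝ} (hs₀ : s₀ ∈ Ioo b c) (h₀ : 0 < f s₀) :
    ∀ s ∈ Ioo b c, 0 < f s := by
  intro s hs
  by_contra h
  obtain ⟨t, ht, ht'⟩ := isPreconnected_Ioo.intermediate_value hs hs₀ hf.continuousOn
    ⟨not_lt.1 h, h₀.le⟩
  exact hne t ht ht'

/-- The normalized Bessel function alternates in sign between consecutive zeros. -/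
lemma besselU_sign (hν : -1 / 2 ≤ ν) (ha : 0 < a) (k : ℕ) :
    ∀ s ∈ Ioo (besselZero ν a k) (besselZero ν a (k + 1)), 0 < (-1) ^ k * besselU ν (a * s) := by
  have hcont : Continuous fun s => besselU ν (a * s) :=
    (continuous_besselU (by linarith)).comp (continuous_const_mul a)
  have hne : ∀ k : ℕ, ∀ s ∈ Ioo (besselZero ν a k) (besselZero ν a (k + 1)),
      (-1) ^ k * besselU ν (a * s) ≠ 0 := fun k s hs =>
    mul_ne_zero (by positivity) ((besselZero_step hν ha k (besselZero_nonneg hν ha k)).2.2 s hs)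
  induction k with
  | zero =>
    have h0 : 0 < besselU ν (a * 0) := by rw [mul_zero]; exact besselU_zero_pos (by linarith)
    have hev : ∀ᶠ s in 𝓝[>] (0 : ℝ), 0 < besselU ν (a * s) :=
      (hcont.continuousAt.eventually (lt_mem_nhds h0)).filter_mono nhdsWithin_le_nhds
    obtain ⟨s, hs, hs'⟩ := (hev.and (Ioo_mem_nhdsGT (besselZero_pos hν ha 0))).exists
    exact pos_on_Ioo_of_ne_zero (continuous_const.mul hcont) (hne 0) (s₀ := s)
      (by simpa [besselZero] using hs') (by simpa using hs)
  | succ k ih =>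
    set c := besselZero ν a (k + 1)
    obtain ⟨hlt, hzero, -⟩ := besselZero_step hν ha k (besselZero_nonneg hν ha k)
    obtain ⟨hlt', -, -⟩ := besselZero_step hν ha (k + 1) (besselZero_nonneg hν ha (k + 1))
    have hc : 0 < c := besselZero_pos hν ha k
    have hd : HasDerivAt (fun s => (-1) ^ (k + 1) * besselU ν (a * s))
        ((-1) ^ (k + 1) * (besselU' ν (a * c) * a)) c :=
      ((hasDerivAt_besselU (by linarith) (a * c)).comp c
        (((hasDerivAt_id c).const_mul a).congr_deriv (by simp))).const_mul _
    have hD : (-1) ^ (k + 1) * (besselU' ν (a * c) * a) ≠ 0 :=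
      mul_ne_zero (by positivity)
        (mul_ne_zero (besselU'_ne_zero hν (by positivity) hzero) ha.ne')
    have hf0 : (-1) ^ (k + 1) * besselU ν (a * c) = 0 := by simp [c, hzero]
    have hleft : ∀ s ∈ Ioo (besselZero ν a k) c, (-1) ^ (k + 1) * besselU ν (a * s) < 0 := by
      intro s hs
      have := ih s hs
      rw [pow_succ]
      linarith
    -- The slopes at `c` from the left are positive by the previous interval, so the derivative is
    -- nonnegative. It is nonzero as the zero is simple, which fixes the sign to the right of `c`.
    have hDpos : 0 < (-1) ^ (k + 1) * (besselU' ν (a * c) * a) := by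
      refine lt_of_le_of_ne ?_ hD.symm
      refine ge_of_tendsto ((hasDerivAt_iff_tendsto_slope.1 hd).mono_left
        (nhdsLT_le_nhdsNE c)) ?_
      filter_upwards [Ioo_mem_nhdsLT hlt] with s hs
      rw [slope_def_field, hf0, sub_zero]
      exact (div_pos_of_neg_of_neg (hleft s hs) (sub_neg.2 hs.2)).le
    have hev : ∀ᶠ s in 𝓝[>] c, 0 < (-1) ^ (k + 1) * besselU ν (a * s) := by
      filter_upwards [((hasDerivAt_iff_tendsto_slope.1 hd).mono_left
        (nhdsGT_le_nhdsNE c)).eventually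
        (lt_mem_nhds hDpos), self_mem_nhdsWithin] with s hs hs'
      rw [slope_def_field, hf0, sub_zero] at hs
      exact (div_pos_iff_of_pos_right (sub_pos.2 hs')).1 hs
    obtain ⟨s, hs, hs'⟩ := (hev.and (Ioo_mem_nhdsGT hlt')).exists
    exact pos_on_Ioo_of_ne_zero (continuous_const.mul hcont) (hne (k + 1)) hs' hs

lemma countable_setOf_besselU_eq_zero (hν : -1 / 2 ≤ ν) (ha : 0 < a) :
    {s : ℝ | 0 ≤ s ∧ besselU ν (a * s) = 0}.Countable := by
  refine (countable_range (besselZero ν a)).mono ?_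
  rintro s ⟨hs, hs0⟩
  rcases hs.eq_or_lt with h | h
  · rw [← h, mul_zero] at hs0
    exact absurd hs0 (besselU_zero_pos (by linarith)).ne'
  · obtain ⟨k, hk, hk'⟩ := exists_besselZero_lt_le hν ha h
    rcases hk'.eq_or_lt with h1 | h1
    · exact ⟨k + 1, h1.symm⟩
    · exact absurd hs0 ((besselZero_step hν ha k (besselZero_nonneg hν ha k)).2.2 s ⟨hk, h1⟩)

end Zeros

/-- With the zeroth zero set to 0, the initial interval becomes the case `k = 0` of a single
alternating rule. -/
lemma hasBesselSignPattern_iff_alternating {d : ℕ} {a : ℝ} {β : ℝ → ℝ} :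
    HasBesselSignPattern d a β ↔
      ∀ k : ℕ, ∀ s ∈ Icc (besselZero ((d : ℝ) / 2) a k) (besselZero ((d : ℝ) / 2) a (k + 1)),
        0 ≤ (-1) ^ k * β s := by
  constructor
  · rintro ⟨h0, h⟩ k s hs
    rcases Nat.even_or_odd' k with ⟨m, rfl | rfl⟩
    · rw [pow_mul, neg_one_sq, one_pow, one_mul]
      rcases Nat.eq_zero_or_pos m with rfl | hm
      · exact h0 s (by simpa [besselZero] using hs)
      · exact (h m hm).2 s hs
    · rw [pow_succ, pow_mul, neg_one_sq, one_pow]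
      have := (h (m + 1) (by omega)).1 s (by
        rw [show 2 * (m + 1) - 1 = 2 * m + 1 by omega, show 2 * (m + 1) = 2 * m + 1 + 1 by ring]
        exact hs)
      linarith
  · intro h
    refine ⟨fun s hs => by simpa using h 0 s (by simpa [besselZero] using hs), fun k hk => ⟨?_, ?_⟩⟩
    · intro s hs
      obtain ⟨m, rfl⟩ := Nat.exists_eq_add_of_le' hk
      have := h (2 * m + 1) s (by
        rw [show 2 * (m + 1) - 1 = 2 * m + 1 by omega, show 2 * (m + 1) = 2 * m + 1 + 1 by ring] at hs
        exact hs)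
      rw [pow_succ, pow_mul, neg_one_sq, one_pow] at this
      linarith
    · intro s hs
      have := h (2 * k) s hs
      rwa [pow_mul, neg_one_sq, one_pow, one_mul] at this

/-- For continuous functions, the Bessel sign pattern says that the product with the normalized
Bessel function is nonnegative. -/
lemma hasBesselSignPattern_iff {d : ℕ} {a : ℝ} (ha : 0 < a) {β : ℝ → ℝ}
    (hβ : ContinuousOn β (Ici 0)) :
    HasBesselSignPattern d a β ↔ ∀ s, 0 ≤ s → 0 ≤ β s * besselU ((d : ℝ) / 2) (a * s) := by
  have hν : -1 / 2 ≤ (d : ℝ) / 2 := by have : (0 : ℝ) ≤ d := d.cast_nonneg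
                                       linarith
  have hsq : ∀ (k : ℕ) (x y : ℝ), x * y = ((-1) ^ k * x) * ((-1) ^ k * y) := by
    intro k x y
    rw [mul_mul_mul_comm, ← pow_add, Even.neg_one_pow ⟨k, rfl⟩, one_mul]
  rw [hasBesselSignPattern_iff_alternating]
  constructor
  · intro h s hs
    rcases hs.eq_or_lt with h0 | h0
    · have h1 := h 0 0 ⟨by simp [besselZero], besselZero_nonneg hν ha 1⟩
      rw [← h0, mul_zero]
      exact mul_nonneg (by simpa using h1) (besselU_zero_pos (by linarith)).le
    · obtain ⟨k, hk, hk'⟩ := exists_besselZero_lt_le hν ha h0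
      rcases hk'.eq_or_lt with h1 | h1
      · rw [h1, (besselZero_step hν ha k (besselZero_nonneg hν ha k)).2.1, mul_zero]
      · rw [hsq k]
        exact mul_nonneg (h k s ⟨hk.le, hk'⟩) (besselU_sign hν ha k s ⟨hk, h1⟩).le
  · intro h k
    have hlt := (besselZero_step hν ha k (besselZero_nonneg hν ha k)).1
    have hsub : Icc (besselZero ((d : ℝ) / 2) a k) (besselZero ((d : ℝ) / 2) a (k + 1)) ⊆ Ici 0 :=
      fun s hs => (besselZero_nonneg hν ha k).trans hs.1
    have hIoo : ∀ s ∈ Ioo (besselZero ((d : ℝ) / 2) a k) (besselZero ((d : ℝ) / 2) a (k + 1)),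
        0 ≤ (-1) ^ k * β s := by
      intro s hs
      have h1 := h s (hsub ⟨hs.1.le, hs.2.le⟩)
      rw [hsq k] at h1
      exact nonneg_of_mul_nonneg_left h1 (besselU_sign hν ha k s hs)
    intro s hs
    -- At the zeros themselves the product carries no information on `β`, so its sign there is
    -- obtained from the open interval by continuity.
    have hcl := closure_Ioo hlt.ne
    have := mem_closure_iff_nhdsWithin_neBot.1 (hcl.symm ▸ hs)
    have hc : ContinuousWithinAt (fun s => (-1) ^ k * β s)
        (Ioo (besselZero ((d : ℝ) / 2) a k) (besselZero ((d : ℝ) / 2) a (k + 1))) s :=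
      continuousWithinAt_const.mul
        ((hβ s (hsub hs)).mono (Ioo_subset_Icc_self.trans hsub))
    exact ge_of_tendsto hc (eventually_nhdsWithin_of_forall hIoo)

/-! ### Integration in polar coordinates -/

section Polar

variable {d : ℕ} [NeZero d]

local notation "𝔼" => EuclideanSpace ℝ (Fin d)

lemma integral_polar {F : 𝔼 → ℝ} (hF : Integrable F) :
    ∫ x, F x = ∫ r in Ioi (0 : ℝ), r ^ (d - 1) *
      ∫ θ : Metric.sphere (0 : 𝔼) 1, F (r • (θ : 𝔼))
        ∂(volume : Measure (𝔼)).toSphere := by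
  have hmp := (volume : Measure 𝔼).measurePreserving_homeomorphUnitSphereProd
  have hdim : Module.finrank ℝ 𝔼 = d := by simp
  rw [hdim] at hmp
  set G : Metric.sphere (0 : 𝔼) 1 × Ioi (0 : ℝ) → ℝ := fun p => F ((p.2 : ℝ) • (p.1 : 𝔼))
  have hG : ∀ x : ({0}ᶜ : Set 𝔼), G (homeomorphUnitSphereProd 𝔼 x) = F x := by
    intro x
    have hx : ‖(x : 𝔼)‖ ≠ 0 := norm_ne_zero_iff.2 x.2
    simp only [G, homeomorphUnitSphereProd_apply_snd_coe, homeomorphUnitSphereProd_apply_fst_coe,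
      smul_smul, mul_inv_cancel₀ hx, one_smul]
  have hint : Integrable G ((volume : Measure 𝔼).toSphere.prod (.volumeIoiPow (d - 1))) := by
    rw [← hmp.integrable_comp_emb (Homeomorph.measurableEmbedding _)]
    have : G ∘ homeomorphUnitSphereProd 𝔼 = F ∘ Subtype.val := funext hG
    rw [this, ← integrableOn_iff_comap_subtypeVal (measurableSet_singleton _).compl]
    exact hF.integrableOn
  calc ∫ x, F x = ∫ x : ({0}ᶜ : Set 𝔼), F x ∂((volume : Measure 𝔼).comap Subtype.val) := by
        rw [integral_subtype_comap (measurableSet_singleton _).compl F, restrict_compl_singleton]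
    _ = ∫ p, G p ∂((volume : Measure 𝔼).toSphere.prod (.volumeIoiPow (d - 1))) := by
        rw [← hmp.integral_comp (Homeomorph.measurableEmbedding _)]
        simp only [hG]
    _ = ∫ r : Ioi (0 : ℝ), ∫ θ, G (θ, r) ∂(volume : Measure 𝔼).toSphere
          ∂(.volumeIoiPow (d - 1)) := integral_prod_symm _ hint
    _ = _ := by
      simp only [Measure.volumeIoiPow, ENNReal.ofReal]
      rw [integral_withDensity_eq_integral_smul]
      · rw [integral_subtype_comap measurableSet_Ioi fun a : ℝ ↦ Real.toNNReal (a ^ (d - 1)) •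
          ∫ θ : Metric.sphere (0 : 𝔼) 1, F (a • (θ : 𝔼)) ∂(volume : Measure 𝔼).toSphere]
        refine setIntegral_congr_fun measurableSet_Ioi fun x hx ↦ ?_
        simp only [NNReal.smul_def, Real.coe_toNNReal _ (pow_nonneg (le_of_lt hx) _), smul_eq_mul]
      · exact (measurable_subtype_coe.pow_const _).real_toNNReal

/-- This transfers measurability and `L^p` norms of radial functions between `ℝ^d` and the
half-line, up to the area of the sphere. -/
lemma map_norm_volume :
    (volume : Measure (𝔼)).map norm =
      (volume : Measure (𝔼)).toSphere univ • radialMeasure d := by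
  have hmp := (volume : Measure 𝔼).measurePreserving_homeomorphUnitSphereProd
  have hdim : Module.finrank ℝ 𝔼 = d := by simp
  rw [hdim] at hmp
  have h1 : (volume : Measure 𝔼) = (volume.comap ((↑) : ({0}ᶜ : Set 𝔼) → 𝔼)).map (↑) := by
    rw [map_comap_subtype_coe (measurableSet_singleton _).compl, restrict_compl_singleton]
  have h2 : (norm : 𝔼 → ℝ) ∘ ((↑) : ({0}ᶜ : Set 𝔼) → 𝔼) =
      ((↑) : Ioi (0 : ℝ) → ℝ) ∘ Prod.snd ∘ homeomorphUnitSphereProd 𝔼 := by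
    ext x; simp
  conv_lhs => rw [h1]
  rw [Measure.map_map measurable_norm measurable_subtype_coe, h2,
    ← Measure.map_map measurable_subtype_coe
      (measurable_snd.comp (homeomorphUnitSphereProd 𝔼).measurable),
    ← Measure.map_map measurable_snd (homeomorphUnitSphereProd 𝔼).measurable, hmp.map_eq,
    Measure.map_snd_prod, Measure.map_smul]
  congr 1
  ext s hs
  rw [Measure.map_apply measurable_subtype_coe hs, Measure.volumeIoiPow, withDensity_apply _
    (measurable_subtype_coe hs), radialMeasure, withDensity_apply _ hs,
    setLIntegral_subtype measurableSet_Ioi _ fun a : ℝ ↦ .ofReal (a ^ (d - 1)),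
    Measure.restrict_restrict hs, Subtype.image_preimage_coe, inter_comm]
  -- Polar coordinates live on `r > 0`, `radialMeasure` on `r ≥ 0`. The two sets differ by a null
  -- set.
  refine setLIntegral_congr ?_
  exact (ae_eq_refl s).inter Ioi_ae_eq_Ici

lemma toSphere_univ_ne_zero :
    (volume : Measure (𝔼)).toSphere univ ≠ 0 := by
  rw [Measure.measure_univ_ne_zero]
  exact Measure.toSphere_ne_zero _

lemma quasiMeasurePreserving_norm :
    Measure.QuasiMeasurePreserving (norm : 𝔼 → ℝ) volume
      (radialMeasure d) :=
  ⟨measurable_norm, by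
    rw [map_norm_volume]
    exact Measure.smul_absolutelyContinuous⟩

lemma eLpNorm_comp_norm {p : ℝ≥0∞} (hp' : p ≠ ∞) {f : ℝ → ℝ}
    (hf : AEStronglyMeasurable f (radialMeasure d)) :
    eLpNorm (fun x : 𝔼 => f ‖x‖) p volume =
      (volume : Measure (𝔼)).toSphere univ ^ (1 / p).toReal *
        eLpNorm f p (radialMeasure d) := by
  have := eLpNorm_map_measure (p := p) (f := (norm : 𝔼 → ℝ)) (g := f)
    (μ := volume) (by rw [map_norm_volume]; exact hf.smul_measure _) measurable_norm.aemeasurable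
  rw [show (fun x : 𝔼 => f ‖x‖) = f ∘ norm from rfl, ← this,
    map_norm_volume, eLpNorm_smul_measure_of_ne_top hp', smul_eq_mul]

lemma memLp_comp_norm_iff {p : ℝ≥0∞} {f : ℝ → ℝ}
    (hf : AEStronglyMeasurable f (radialMeasure d)) :
    MemLp (fun x : 𝔼 => f ‖x‖) p volume ↔ MemLp f p (radialMeasure d) := by
  have hc := toSphere_univ_ne_zero (d := d)
  have hc' := measure_ne_top (volume : Measure (𝔼)).toSphere univ
  have := memLp_map_measure_iff (p := p) (f := (norm : 𝔼 → ℝ)) (g := f)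
    (μ := volume) (by rw [map_norm_volume]; exact hf.smul_measure _) measurable_norm.aemeasurable
  rw [show (fun x : 𝔼 => f ‖x‖) = f ∘ norm from rfl, ← this,
    map_norm_volume]
  refine ⟨fun h => ?_, fun h => h.smul_measure hc'⟩
  have := h.smul_measure (c := (Measure.toSphere volume univ)⁻¹) (ENNReal.inv_ne_top.2 hc)
  rwa [smul_smul, ENNReal.inv_mul_cancel hc hc', one_smul] at this

/-! ### The Fourier transform of the sphere -/

lemma integral_pow_mul_exp_neg_sq (k : ℕ) :
    ∫ t : ℝ, t ^ (2 * k) * Real.exp (-t ^ 2) = Real.Gamma (k + 1 / 2) := by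
  have h1 : ∀ t : ℝ, t ^ (2 * k) * Real.exp (-t ^ 2) =
      (fun t : ℝ => t ^ (2 * k) * Real.exp (-t ^ 2)) |t| := by
    intro t
    simp only [sq_abs, pow_mul]
  have h2 := integral_rpow_mul_exp_neg_rpow (p := 2) (q := 2 * k) (by norm_num)
    (by have : (0 : ℝ) ≤ k := k.cast_nonneg
        linarith)
  rw [integral_congr_ae (Eventually.of_forall h1),
    integral_comp_abs (f := fun t : ℝ => t ^ (2 * k) * Real.exp (-t ^ 2))]
  have h3 : ∫ x in Ioi (0 : ℝ), x ^ (2 * k) * Real.exp (-x ^ 2) =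
      ∫ x in Ioi (0 : ℝ), x ^ (2 * (k : ℝ)) * Real.exp (-x ^ (2 : ℝ)) := by
    refine setIntegral_congr_fun measurableSet_Ioi fun x _ => ?_
    rw [show (2 * (k : ℝ)) = ((2 * k : ℕ) : ℝ) by push_cast; ring, Real.rpow_natCast,
      Real.rpow_two]
  rw [h3, h2, show (2 * (k : ℝ) + 1) / 2 = k + 1 / 2 by ring]
  ring

lemma integrable_pow_mul_exp_neg_sq (k : ℕ) :
    Integrable fun t : ℝ => t ^ (2 * k) * Real.exp (-t ^ 2) := by
  have := integral_pow_mul_exp_neg_sq k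
  -- A non-integrable function would have integral 0 by convention, but the computed value is
  -- positive.
  by_contra h
  rw [integral_undef h] at this
  exact (Real.Gamma_pos_of_pos (by positivity : (0 : ℝ) < k + 1 / 2)).ne this

lemma coord_gaussian_eq_prod (k : ℕ) (x : 𝔼) :
    x 0 ^ (2 * k) * Real.exp (-‖x‖ ^ 2) =
      ∏ i : Fin d, (x i ^ (2 * (if i = 0 then k else 0)) * Real.exp (-x i ^ 2)) := by
  rw [Finset.prod_mul_distrib, ← Real.exp_sum, EuclideanSpace.norm_sq_eq, Finset.sum_neg_distrib,
    Finset.prod_eq_single (0 : Fin d) (by intro i _ hi; simp [hi]) (by simp)]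
  simp

lemma integrable_coord_gaussian (k : ℕ) :
    Integrable fun x : 𝔼 => x 0 ^ (2 * k) * Real.exp (-‖x‖ ^ 2) := by
  simp_rw [coord_gaussian_eq_prod]
  rw [← (EuclideanSpace.volume_preserving_symm_measurableEquiv_toLp (Fin d)).symm.integrable_comp_emb
    (MeasurableEquiv.measurableEmbedding _)]
  exact Integrable.fintype_prod (f := fun (i : Fin d) (t : ℝ) =>
    t ^ (2 * (if i = 0 then k else 0)) * Real.exp (-t ^ 2))
    fun i => integrable_pow_mul_exp_neg_sq _

lemma integral_coord_gaussian (k : ℕ) :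
    ∫ x : 𝔼, x 0 ^ (2 * k) * Real.exp (-‖x‖ ^ 2) =
      Real.Gamma (k + 1 / 2) * Real.Gamma (1 / 2) ^ (d - 1) := by
  simp_rw [coord_gaussian_eq_prod]
  rw [← (EuclideanSpace.volume_preserving_symm_measurableEquiv_toLp (Fin d)).symm.integral_comp
    (MeasurableEquiv.measurableEmbedding _)]
  have := integral_fintype_prod_volume_eq_prod (fun (i : Fin d) (t : ℝ) =>
    t ^ (2 * (if i = 0 then k else 0)) * Real.exp (-t ^ 2))
  refine this.trans ?_
  simp_rw [integral_pow_mul_exp_neg_sq]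
  rw [← Finset.mul_prod_erase _ _ (Finset.mem_univ (0 : Fin d))]
  refine congrArg₂ (· * ·) ?_ ?_
  · simp
  · rw [Finset.prod_congr rfl (g := fun _ => Real.Gamma (1 / 2))]
    · simp
    · intro i hi
      simp [Finset.ne_of_mem_erase hi]

/-- Vectors of equal norm are related by a linear isometry. -/
lemma exists_linearIsometryEquiv_apply_eq {E : Type*} [NormedAddCommGroup E]
    [InnerProductSpace ℝ E] {v w : E} (h : ‖v‖ = ‖w‖) : ∃ A : E ≃ₗᵢ[ℝ] E, A v = w :=
  ⟨(Submodule.span ℝ {v - w})ᗮ.reflection, Submodule.reflection_sub h⟩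

lemma exists_isometry_inner_eq (ξ : 𝔼) :
    ∃ A : 𝔼 ≃ₗᵢ[ℝ] 𝔼,
      ∀ x, inner ℝ (A x) ξ = ‖ξ‖ * x 0 := by
  obtain ⟨A, hA⟩ := exists_linearIsometryEquiv_apply_eq
    (v := EuclideanSpace.single (0 : Fin d) ‖ξ‖) (w := ξ) (by simp)
  refine ⟨A, fun x => ?_⟩
  conv_lhs => rw [← hA]
  rw [A.inner_map_map, EuclideanSpace.inner_single_right]
  simp

/-- An isometry turns `ξ` into a multiple of the first basis vector, where the Gaussian moment
factors over the coordinates. -/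
lemma gaussian_moment (ξ : 𝔼) (k : ℕ) :
    Integrable (fun x : 𝔼 => inner ℝ x ξ ^ (2 * k) * Real.exp (-‖x‖ ^ 2)) ∧
    ∫ x : 𝔼, inner ℝ x ξ ^ (2 * k) * Real.exp (-‖x‖ ^ 2) =
      ‖ξ‖ ^ (2 * k) * (Real.Gamma (k + 1 / 2) * Real.Gamma (1 / 2) ^ (d - 1)) := by
  obtain ⟨A, hA⟩ := exists_isometry_inner_eq ξ
  have hAm := A.measurePreserving
  have hemb := A.toHomeomorph.measurableEmbedding
  have hcomp : (fun x : 𝔼 => inner ℝ x ξ ^ (2 * k) * Real.exp (-‖x‖ ^ 2)) ∘ A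
      = fun x => ‖ξ‖ ^ (2 * k) * (x 0 ^ (2 * k) * Real.exp (-‖x‖ ^ 2)) := by
    ext x
    simp only [Function.comp, hA, A.norm_map, mul_pow, mul_assoc]
  constructor
  · rw [← hAm.integrable_comp_emb hemb, hcomp]
    exact (integrable_coord_gaussian k).const_mul _
  · rw [← hAm.integral_comp hemb]
    have : ∀ x, inner ℝ (A x) ξ ^ (2 * k) * Real.exp (-‖A x‖ ^ 2) =
      ‖ξ‖ ^ (2 * k) * (x 0 ^ (2 * k) * Real.exp (-‖x‖ ^ 2)) := fun x => congrFun hcomp x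
    simp_rw [this]
    rw [integral_const_mul, integral_coord_gaussian]

/-- The Gaussian moment is computed twice. Coordinates give Gamma values at half-integers; polar
coordinates give the spherical moment times the radial integral `Γ(k + d/2)/2`. -/
lemma sphere_moment (ξ : 𝔼) (k : ℕ) :
    ∫ θ : Metric.sphere (0 : 𝔼) 1,
      inner ℝ (θ : 𝔼) ξ ^ (2 * k)
        ∂(volume : Measure (𝔼)).toSphere =
      2 * (‖ξ‖ ^ (2 * k) * (Real.Gamma (k + 1 / 2) * Real.Gamma (1 / 2) ^ (d - 1))) /
        Real.Gamma (k + d / 2) := by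
  obtain ⟨hint, hval⟩ := gaussian_moment ξ k
  rw [integral_polar hint] at hval
  set M := ∫ θ : Metric.sphere (0 : 𝔼) 1,
      inner ℝ (θ : 𝔼) ξ ^ (2 * k)
        ∂(volume : Measure (𝔼)).toSphere with hM
  have hd : 0 < d := Nat.pos_of_ne_zero (NeZero.ne d)
  have hd' : (0 : ℝ) < d := by exact_mod_cast hd
  have hk : (0 : ℝ) ≤ k := k.cast_nonneg
  have h1 : ∀ r ∈ Ioi (0 : ℝ), r ^ (d - 1) *
      ∫ θ : Metric.sphere (0 : 𝔼) 1,
        inner ℝ (r • (θ : 𝔼)) ξ ^ (2 * k) *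
          Real.exp (-‖r • (θ : 𝔼)‖ ^ 2)
        ∂(volume : Measure (𝔼)).toSphere =
      M * (r ^ (2 * (k : ℝ) + (d - 1)) * Real.exp (-r ^ (2 : ℝ))) := by
    intro r hr
    have hr' : (0 : ℝ) < r := hr
    have h2 : ∀ θ : Metric.sphere (0 : 𝔼) 1,
        inner ℝ (r • (θ : 𝔼)) ξ ^ (2 * k) *
          Real.exp (-‖r • (θ : 𝔼)‖ ^ 2) =
        (r ^ (2 * k) * Real.exp (-r ^ 2)) * inner ℝ (θ : 𝔼) ξ ^ (2 * k) := by
      intro θ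
      rw [real_inner_smul_left, norm_smul, Real.norm_of_nonneg hr'.le, norm_eq_of_mem_sphere θ]
      ring_nf
    simp_rw [h2]
    rw [integral_const_mul, ← hM, Real.rpow_two,
      show 2 * (k : ℝ) + (d - 1) = ((d - 1 + 2 * k : ℕ) : ℝ) by
        push_cast [Nat.cast_sub hd]; ring, Real.rpow_natCast, pow_add]
    ring
  rw [setIntegral_congr_fun measurableSet_Ioi h1, integral_const_mul,
    integral_rpow_mul_exp_neg_rpow (by norm_num) (by linarith),
    show (2 * (k : ℝ) + (d - 1) + 1) / 2 = k + d / 2 by ring] at hval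
  have hg : Real.Gamma (k + d / 2) ≠ 0 := (Real.Gamma_pos_of_pos (by positivity)).ne'
  rw [eq_div_iff hg, ← hval]
  ring

lemma Gamma_nat_add_half_mul (k : ℕ) :
    Real.Gamma (k + 1 / 2) * (4 ^ k * k.factorial) = (2 * k).factorial * Real.sqrt Real.pi := by
  induction k with
  | zero => rw [← Real.Gamma_one_half_eq]; simp
  | succ k ih =>
    have hk : (0 : ℝ) ≤ k := k.cast_nonneg
    rw [show ((k + 1 : ℕ) : ℝ) + 1 / 2 = (k + 1 / 2) + 1 by push_cast; ring,
      Real.Gamma_add_one (by positivity), show 2 * (k + 1) = 2 * k + 1 + 1 by ring,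
      Nat.factorial_succ, Nat.factorial_succ, Nat.factorial_succ, pow_succ]
    push_cast
    linear_combination ((k + 1 / 2) * 4 * (k + 1) : ℝ) * ih

/-- The cosine series is integrated term by term over the sphere. `Gamma_nat_add_half_mul` turns the
spherical moments into the coefficients of `besselPhi (d/2 - 1)`. -/
lemma integral_sphere_cos (ξ : 𝔼) :
    ∫ θ : Metric.sphere (0 : 𝔼) 1,
      Real.cos (inner ℝ (θ : 𝔼) ξ)
        ∂(volume : Measure (𝔼)).toSphere =
      2 * Real.pi ^ ((d : ℝ) / 2) * besselU ((d : ℝ) / 2 - 1) ‖ξ‖ := by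
  set F : ℕ → Metric.sphere (0 : 𝔼) 1 → ℝ := fun k θ =>
    (-1) ^ k * inner ℝ (θ : 𝔼) ξ ^ (2 * k) / (2 * k).factorial
  have hbound : ∀ k θ, ‖F k θ‖ ≤ ‖ξ‖ ^ (2 * k) / (2 * k).factorial := by
    intro k θ
    simp only [F, norm_div, norm_mul, norm_pow, norm_neg, norm_one, one_pow, one_mul,
      RCLike.norm_natCast]
    gcongr
    calc ‖inner ℝ (θ : 𝔼) ξ‖ ≤ ‖(θ : 𝔼)‖ * ‖ξ‖ := norm_inner_le_norm _ _
      _ = ‖ξ‖ := by rw [norm_eq_of_mem_sphere θ, one_mul]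
  have hFc : ∀ k, Continuous (F k) := fun k => by fun_prop
  have hFi : ∀ k, Integrable (F k) (volume : Measure 𝔼).toSphere := fun k =>
    Integrable.of_bound (hFc k).aestronglyMeasurable _ (Eventually.of_forall (hbound k))
  have hsum : Summable fun k : ℕ => ‖ξ‖ ^ (2 * k) / (2 * k).factorial :=
    (Real.summable_pow_div_factorial ‖ξ‖).comp_injective
      (i := fun k : ℕ => 2 * k) (fun a b h => by simpa using h)
  have hS : Summable fun k => ∫ θ, ‖F k θ‖ ∂(volume : Measure 𝔼).toSphere := by
    refine Summable.of_nonneg_of_le (fun k => integral_nonneg fun θ => norm_nonneg _)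
      (fun k => ?_) (hsum.mul_right ((volume : Measure 𝔼).toSphere.real univ))
    calc ∫ θ, ‖F k θ‖ ∂(volume : Measure 𝔼).toSphere
        ≤ ∫ θ, ‖ξ‖ ^ (2 * k) / (2 * k).factorial ∂(volume : Measure 𝔼).toSphere :=
          integral_mono (hFi k).norm (integrable_const _) (hbound k)
      _ = _ := by rw [integral_const, smul_eq_mul, mul_comm]
  have h := hasSum_integral_of_summable_integral_norm hFi hS
  have hcos : ∀ θ : Metric.sphere (0 : 𝔼) 1, ∑' k, F k θ = Real.cos (inner ℝ (θ : 𝔼) ξ) := by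
    intro θ
    exact (Real.hasSum_cos (inner ℝ (θ : 𝔼) ξ)).tsum_eq
  simp_rw [hcos] at h
  rw [← h.tsum_eq, besselU, besselPhi, ← tsum_mul_left]
  refine tsum_congr fun k => ?_
  have e1 : ∫ θ, F k θ ∂(volume : Measure 𝔼).toSphere =
      (-1) ^ k * (∫ θ : Metric.sphere (0 : 𝔼) 1, inner ℝ (θ : 𝔼) ξ ^ (2 * k)
        ∂(volume : Measure 𝔼).toSphere) / (2 * k).factorial := by
    simp only [F]
    rw [integral_div, integral_const_mul]
  have hd : 0 < d := Nat.pos_of_ne_zero (NeZero.ne d)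
  have hd' : (0 : ℝ) < d := by exact_mod_cast hd
  have e2 : Real.Gamma (1 / 2) ^ (d - 1) * Real.sqrt Real.pi = Real.pi ^ ((d : ℝ) / 2) := by
    rw [Real.Gamma_one_half_eq, ← pow_succ, Nat.sub_add_cancel hd, Real.sqrt_eq_rpow,
      ← Real.rpow_natCast, ← Real.rpow_mul Real.pi_pos.le]
    congr 1; ring
  have e3 := Gamma_nat_add_half_mul k
  have hg : Real.Gamma (k + d / 2) ≠ 0 := (Real.Gamma_pos_of_pos (by positivity)).ne'
  have hf : (k.factorial : ℝ) ≠ 0 := by positivity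
  have hf2 : ((2 * k).factorial : ℝ) ≠ 0 := by positivity
  rw [e1, sphere_moment, besselCoeff, show (k : ℝ) + (d / 2 - 1) + 1 = k + d / 2 by ring, ← e2,
    div_pow, ← pow_mul]
  have e4 : Real.Gamma (k + 1 / 2) = (2 * k).factorial * Real.sqrt Real.pi / (4 ^ k * k.factorial) := by
    rw [← e3]; field_simp
  rw [e4]
  field_simp

/-- The Fourier transform of an integrable radial function. -/
lemma integral_radial_mul_cos {f : ℝ → ℝ}
    (hf : Integrable fun x : 𝔼 => f ‖x‖) (ξ : 𝔼) :
    ∫ x : 𝔼, f ‖x‖ * Real.cos (inner ℝ x ξ) =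
      2 * Real.pi ^ ((d : ℝ) / 2) * ∫ r in Ioi (0 : ℝ),
        f r * r ^ (d - 1) * besselU ((d : ℝ) / 2 - 1) (r * ‖ξ‖) := by
  have hint : Integrable fun x : 𝔼 => f ‖x‖ * Real.cos (inner ℝ x ξ) := by
    refine hf.mul_bdd (c := 1) ?_ (Eventually.of_forall fun x => Real.abs_cos_le_one _)
    exact (by fun_prop : Continuous fun x : 𝔼 =>
      Real.cos (inner ℝ x ξ)).aestronglyMeasurable
  rw [integral_polar hint, ← integral_const_mul]
  refine setIntegral_congr_fun measurableSet_Ioi fun r hr => ?_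
  have hr' : (0 : ℝ) < r := hr
  have h2 : ∀ θ : Metric.sphere (0 : 𝔼) 1,
      f ‖r • (θ : 𝔼)‖ *
        Real.cos (inner ℝ (r • (θ : 𝔼)) ξ) =
      f r * Real.cos (inner ℝ (θ : 𝔼) (r • ξ)) := by
    intro θ
    rw [real_inner_smul_left, real_inner_smul_right, norm_smul, Real.norm_of_nonneg hr'.le,
      norm_eq_of_mem_sphere θ, mul_one]
  simp only [h2]
  rw [integral_const_mul, integral_sphere_cos, norm_smul, Real.norm_of_nonneg hr'.le]
  ring

/-- By the recurrence, `r^n/2 · besselU ν (r s)` is an antiderivative in `r`. This is the classical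
identity `(x^ν J_ν)' = x^ν J_{ν-1}`, and it raises the order from `d/2 - 1` for spheres to `d/2` for
balls. -/
lemma integral_pow_mul_besselU (ν : ℝ) (hν : 0 < ν) {n : ℕ} (hn : (n : ℝ) = 2 * ν) (hn0 : n ≠ 0)
    {a : ℝ} (ha : 0 ≤ a) (s : ℝ) :
    ∫ r in Ioc 0 a, r ^ (n - 1) * besselU (ν - 1) (r * s) = a ^ n / 2 * besselU ν (a * s) := by
  rw [← intervalIntegral.integral_of_le ha]
  have hder : ∀ r : ℝ, HasDerivAt (fun r => r ^ n / 2 * besselU ν (r * s))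
      (r ^ (n - 1) * besselU (ν - 1) (r * s)) r := by
    intro r
    have h1 : HasDerivAt (fun r => besselU ν (r * s)) (-(r * s / 2) * besselU (ν + 1) (r * s) * s) r :=
      (hasDerivAt_besselU (ν := ν) (by linarith) (r * s)).comp r
        (h := fun r => r * s) (((hasDerivAt_id r).mul_const s).congr_deriv (by simp))
    refine (((hasDerivAt_pow n r).div_const 2).mul h1).congr_deriv ?_
    have h2 := besselPhi_recurrence (by linarith : -1 < ν - 1) ((r * s) ^ 2 / 4)
    simp only [besselU]
    rw [h2, show ν - 1 + 1 = ν by ring, show ν - 1 + 2 = ν + 1 by ring, hn]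
    have : r ^ n = r ^ (n - 1) * r := by rw [← pow_succ, Nat.sub_add_cancel (by omega)]
    rw [this]
    ring
  have hc : Continuous fun r : ℝ => r ^ (n - 1) * besselU (ν - 1) (r * s) :=
    (continuous_pow _).mul ((continuous_besselU (by linarith)).comp (continuous_mul_const s))
  rw [intervalIntegral.integral_eq_sub_of_hasDerivAt (fun r _ => hder r)
    (hc.intervalIntegrable _ _)]
  simp [hn0]

/-- The Fourier transform of the indicator function of a ball. -/
lemma integral_ball_cos {a : ℝ} (ha : 0 ≤ a) (ξ : 𝔼) :
    ∫ x : 𝔼, (Metric.closedBall 0 a).indicator 1 x * Real.cos (inner ℝ x ξ) =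
      Real.pi ^ ((d : ℝ) / 2) * a ^ d * besselU ((d : ℝ) / 2) (a * ‖ξ‖) := by
  have hd : 0 < d := Nat.pos_of_ne_zero (NeZero.ne d)
  have hd' : (0 : ℝ) < d := by exact_mod_cast hd
  have hball : ∀ x : 𝔼,
      (Metric.closedBall 0 a).indicator (1 : 𝔼 → ℝ) x =
        (Iic a).indicator (1 : ℝ → ℝ) ‖x‖ := by
    intro x
    by_cases h : ‖x‖ ≤ a <;> simp [h]
  simp_rw [hball]
  rw [integral_radial_mul_cos]
  · have : ∀ r : ℝ, (Iic a).indicator (1 : ℝ → ℝ) r * r ^ (d - 1) *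
        besselU ((d : ℝ) / 2 - 1) (r * ‖ξ‖) = (Iic a).indicator
          (fun r => r ^ (d - 1) * besselU ((d : ℝ) / 2 - 1) (r * ‖ξ‖)) r := by
      intro r
      by_cases h : r ≤ a <;> simp [h]
    simp_rw [this]
    rw [setIntegral_indicator measurableSet_Iic, Ioi_inter_Iic,
      integral_pow_mul_besselU ((d : ℝ) / 2) (by positivity) (by ring) hd.ne' ha]
    ring
  · simp_rw [← hball]
    exact (integrable_indicator_iff measurableSet_closedBall).2
      (integrableOn_const measure_closedBall_lt_top.ne)

end Polar

/-! ### The Fourier transform on `L¹ ∩ L²` -/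

section Fourier

variable {V : Type*} [NormedAddCommGroup V] [InnerProductSpace ℝ V] [FiniteDimensional ℝ V]
  [MeasurableSpace V] [BorelSpace V]

lemma continuous_fourier_of_integrable {f : V → ℂ} (hf : Integrable f) : Continuous (𝓕 f) :=
  VectorFourier.fourierIntegral_continuous Real.continuous_fourierChar
    (L := innerₗ V) continuous_inner hf

/-- Equality as tempered distributions suffices, since compactly supported smooth functions already
separate locally integrable ones. -/
lemma ae_eq_of_integral_schwartz_smul_eq {F h : V → ℂ} (hF : MemLp F 2) (hh : Continuous h)
    (H : ∀ φ : SchwartzMap V ℂ, ∫ x, φ x • F x = ∫ x, φ x • h x) : F =ᵐ[volume] h := by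
  refine ae_eq_of_integral_contDiff_smul_eq (hF.locallyIntegrable (by norm_num))
    hh.locallyIntegrable fun ψ hψ hψc => ?_
  have hg₁ : HasCompactSupport (Complex.ofRealCLM ∘ ψ) := hψc.comp_left rfl
  have hg₂ : ContDiff ℝ (⊤ : ℕ∞) (Complex.ofRealCLM ∘ ψ) := Complex.ofRealCLM.contDiff.comp hψ
  simpa using H (hg₁.toSchwartzMap hg₂)

lemma integral_schwartz_fourier_smul {f : V → ℂ} (h1 : Integrable f) (φ : SchwartzMap V ℂ) :
    ∫ x, (𝓕 φ : SchwartzMap V ℂ) x • f x = ∫ x, φ x • 𝓕 f x := by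
  have := VectorFourier.integral_fourierIntegral_smul_eq_flip (μ := (volume : Measure V))
    (ν := (volume : Measure V)) (L := innerₗ V) Real.continuous_fourierChar continuous_inner
    φ.integrable h1
  rw [flip_innerₗ] at this
  rw [SchwartzMap.fourier_coe]
  exact this

/-- The Fourier transform in `L²` of a function in `L¹ ∩ L²` is given by the Fourier integral. -/
lemma fourier_toLp_ae_eq {f : V → ℂ} (h1 : Integrable f) (h2 : MemLp f 2) :
    (𝓕 (h2.toLp f) : Lp (α := V) ℂ 2) =ᵐ[volume] 𝓕 f := by
  refine ae_eq_of_integral_schwartz_smul_eq (Lp.memLp _) (continuous_fourier_of_integrable h1)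
    fun φ => ?_
  -- The `L²` transform is defined by extension, but as a distribution it acts by moving the
  -- transform onto the test function, just as the Fourier integral does.
  have := congrArg (fun T => T φ) (Lp.fourier_toTemperedDistribution_eq (h2.toLp f))
  simp only [TemperedDistribution.fourier_apply, Lp.toTemperedDistribution_apply] at this
  rw [← this, ← integral_schwartz_fourier_smul h1]
  refine integral_congr_ae ?_
  filter_upwards [h2.coeFn_toLp] with x hx
  rw [hx]

/-- On even functions the inverse Fourier transform is the Fourier transform. -/
lemma fourierInv_toLp_ae_eq {f : V → ℂ} (h1 : Integrable f) (h2 : MemLp f 2)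
    (heven : ∀ x, f (-x) = f x) :
    (𝓕⁻ (h2.toLp f) : Lp (α := V) ℂ 2) =ᵐ[volume] 𝓕 f := by
  refine ae_eq_of_integral_schwartz_smul_eq (Lp.memLp _) (continuous_fourier_of_integrable h1)
    fun φ => ?_
  have := congrArg (fun T => T φ) (Lp.fourierInv_toTemperedDistribution_eq (h2.toLp f))
  simp only [TemperedDistribution.fourierInv_apply, Lp.toTemperedDistribution_apply] at this
  rw [← this, ← integral_schwartz_fourier_smul h1, ← integral_neg_eq_self]
  refine integral_congr_ae ?_
  filter_upwards [(Measure.measurePreserving_neg (volume : Measure V)).quasiMeasurePreserving.ae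
    h2.coeFn_toLp] with x hx
  rw [hx, heven, SchwartzMap.fourierInv_coe, SchwartzMap.fourier_coe,
    Real.fourierInv_eq_fourier_neg, neg_neg]

lemma memLp_fourier {f : V → ℂ} (h1 : Integrable f) (h2 : MemLp f 2) : MemLp (𝓕 f) 2 :=
  (memLp_congr_ae (fourier_toLp_ae_eq h1 h2)).1 (Lp.memLp _)

/-- Plancherel's identity for functions in `L¹ ∩ L²`. -/
lemma integral_conj_mul_eq_integral_fourier {f g : V → ℂ} (hf1 : Integrable f) (hf2 : MemLp f 2)
    (hg1 : Integrable g) (hg2 : MemLp g 2) :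
    ∫ x, f x * (starRingEnd ℂ) (g x) = ∫ ξ, 𝓕 f ξ * (starRingEnd ℂ) (𝓕 g ξ) := by
  have h := Lp.inner_fourier_eq (hg2.toLp g) (hf2.toLp f)
  rw [L2.inner_def, L2.inner_def] at h
  refine Eq.trans ?_ (h.symm.trans ?_)
  · refine integral_congr_ae ?_
    filter_upwards [hf2.coeFn_toLp, hg2.coeFn_toLp] with x h1 h2
    rw [h1, h2]; rfl
  · refine integral_congr_ae ?_
    filter_upwards [fourier_toLp_ae_eq hf1 hf2, fourier_toLp_ae_eq hg1 hg2] with x h1 h2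
    rw [h1, h2]; rfl

lemma fourier_comp_sub (f : V → ℂ) (y ξ : V) :
    𝓕 (fun x => f (x - y)) ξ = (𝐞 (-inner ℝ y ξ) : ℂ) * 𝓕 f ξ := by
  have h : 𝓕 (fun x => f (x - y)) ξ = ∫ x, (𝐞 (-inner ℝ (x + y) ξ) : ℂ) * f x := by
    rw [Real.fourier_eq, ← integral_add_right_eq_self _ y]
    simp only [add_sub_cancel_right, Circle.smul_def, smul_eq_mul]
  rw [h, Real.fourier_eq, ← integral_const_mul]
  refine integral_congr_ae (Eventually.of_forall fun x => ?_)
  simp only [inner_add_left, neg_add, AddChar.map_add_eq_mul, Circle.coe_mul, Circle.smul_def,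
    smul_eq_mul]
  ring

/-! ### Cosine transforms and correlations of even real functions. -/

lemma fourierChar_eq_cos_add_sin (t : ℝ) :
    (𝐞 t : ℂ) = (Real.cos (2 * Real.pi * t) : ℂ) + (Real.sin (2 * Real.pi * t) : ℂ) * Complex.I := by
  rw [Real.fourierChar_apply, Complex.exp_mul_I, Complex.ofReal_cos, Complex.ofReal_sin]

/-- The cosine transform `ξ ↦ ∫ h(x) cos (2π⟨x, ξ⟩) dx`. -/
noncomputable def cosTransform (h : V → ℝ) (ξ : V) : ℝ :=
  ∫ x, h x * Real.cos (2 * Real.pi * inner ℝ x ξ)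

lemma integrable_mul_cos {h : V → ℝ} (hh : Integrable h) (ξ : V) :
    Integrable fun x => h x * Real.cos (2 * Real.pi * inner ℝ x ξ) :=
  hh.mul_bdd (c := 1) (by fun_prop : Continuous fun x : V =>
    Real.cos (2 * Real.pi * inner ℝ x ξ)).aestronglyMeasurable
    (Eventually.of_forall fun x => Real.abs_cos_le_one _)

lemma integrable_mul_sin {h : V → ℝ} (hh : Integrable h) (ξ : V) :
    Integrable fun x => h x * Real.sin (2 * Real.pi * inner ℝ x ξ) :=
  hh.mul_bdd (c := 1) (by fun_prop : Continuous fun x : V =>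
    Real.sin (2 * Real.pi * inner ℝ x ξ)).aestronglyMeasurable
    (Eventually.of_forall fun x => Real.abs_sin_le_one _)

lemma integral_fourierChar_mul {h : V → ℝ} (hh : Integrable h) (heven : ∀ x, h (-x) = h x) (ξ : V) :
    ∫ x, (𝐞 (inner ℝ x ξ) : ℂ) * (h x : ℂ) = (cosTransform h ξ : ℂ) := by
  have hs : ∫ x, h x * Real.sin (2 * Real.pi * inner ℝ x ξ) = 0 := by
    have h1 := integral_neg_eq_self (fun x : V => h x * Real.sin (2 * Real.pi * inner ℝ x ξ)) volume
    simp only [heven, inner_neg_left, mul_neg, Real.sin_neg] at h1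
    rw [integral_neg] at h1
    linarith
  have e : ∀ x : V, (𝐞 (inner ℝ x ξ) : ℂ) * (h x : ℂ) =
      ((h x * Real.cos (2 * Real.pi * inner ℝ x ξ) : ℝ) : ℂ) +
        ((h x * Real.sin (2 * Real.pi * inner ℝ x ξ) : ℝ) : ℂ) * Complex.I := by
    intro x
    rw [fourierChar_eq_cos_add_sin]
    push_cast; ring
  simp_rw [e]
  rw [integral_add (integrable_mul_cos hh ξ).ofReal
    ((integrable_mul_sin hh ξ).ofReal.mul_const _), integral_mul_const,
    integral_complex_ofReal, integral_complex_ofReal, hs, cosTransform]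
  simp

lemma fourier_ofReal_eq_cosTransform {h : V → ℝ} (hh : Integrable h) (heven : ∀ x, h (-x) = h x)
    (ξ : V) : 𝓕 (fun x => (h x : ℂ)) ξ = (cosTransform h ξ : ℂ) := by
  rw [← integral_fourierChar_mul hh heven, Real.fourier_eq, ← integral_neg_eq_self]
  simp only [inner_neg_left, neg_neg, heven, Circle.smul_def, smul_eq_mul]

lemma continuous_cosTransform {h : V → ℝ} (hh : Integrable h) : Continuous (cosTransform h) :=
  continuous_of_dominated (fun ξ => (integrable_mul_cos hh ξ).aestronglyMeasurable)
    (fun ξ => Eventually.of_forall fun x => by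
      rw [norm_mul]
      exact mul_le_of_le_one_right (norm_nonneg _) (Real.abs_cos_le_one _)) hh.norm
    (Eventually.of_forall fun x => by fun_prop)

lemma cosTransform_neg (h : V → ℝ) (ξ : V) : cosTransform h (-ξ) = cosTransform h ξ := by
  simp [cosTransform]

lemma memLp_cosTransform {h : V → ℝ} (hh : Integrable h) (hh2 : MemLp h 2)
    (heven : ∀ x, h (-x) = h x) : MemLp (cosTransform h) 2 := by
  have := (memLp_fourier hh.ofReal (hh2.ofReal (K := ℂ))).re
  refine (memLp_congr_ae (Eventually.of_forall fun ξ => ?_)).1 this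
  exact congrArg Complex.re (fourier_ofReal_eq_cosTransform hh heven ξ)

lemma tendsto_cosTransform_cocompact {h : V → ℝ} (hh : Integrable h) (heven : ∀ x, h (-x) = h x) :
    Tendsto (cosTransform h) (cocompact V) (𝓝 0) := by
  have h1 := tendsto_integral_exp_inner_smul_cocompact (fun x => (h x : ℂ))
  have h2 := (Complex.continuous_re.tendsto 0).comp h1
  rw [Complex.zero_re] at h2
  refine h2.congr fun ξ => ?_
  exact congrArg Complex.re (fourier_ofReal_eq_cosTransform hh heven ξ)

variable {g χ : V → ℝ}

/-- The correlation of two even functions in `L¹ ∩ L²` is the cosine transform of the product of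
their cosine transforms. -/
lemma integral_translates_mul (hg1 : Integrable g) (hg2 : MemLp g 2) (hge : ∀ x, g (-x) = g x)
    (hχ1 : Integrable χ) (hχ2 : MemLp χ 2) (hχe : ∀ x, χ (-x) = χ x) (y z : V) :
    ∫ x, g (x - y) * χ (x - z) =
      cosTransform (fun ξ => cosTransform g ξ * cosTransform χ ξ) (z - y) := by
  have hm : Integrable fun ξ => cosTransform g ξ * cosTransform χ ξ :=
    (memLp_cosTransform hg1 hg2 hge).integrable_mul (memLp_cosTransform hχ1 hχ2 hχe)
  have tr (y : V) : MeasurePreserving (fun x : V => x - y) volume volume :=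
    measurePreserving_sub_right volume y
  have i1 := (hg1.comp_sub_right y).ofReal (𝕜 := ℂ)
  have i2 := (hg2.comp_measurePreserving (tr y)).ofReal (K := ℂ)
  have j1 := (hχ1.comp_sub_right z).ofReal (𝕜 := ℂ)
  have j2 := (hχ2.comp_measurePreserving (tr z)).ofReal (K := ℂ)
  have h : ∫ x, (g (x - y) : ℂ) * (starRingEnd ℂ) (χ (x - z) : ℂ) =
      ∫ ξ, 𝓕 (fun x => (g (x - y) : ℂ)) ξ * (starRingEnd ℂ) (𝓕 (fun x => (χ (x - z) : ℂ)) ξ) :=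
    integral_conj_mul_eq_integral_fourier i1 i2 j1 j2
  have e1 := fourier_comp_sub (fun x => (g x : ℂ)) y
  have e2 := fourier_comp_sub (fun x => (χ x : ℂ)) z
  have e3 : ∀ ξ, (𝐞 (-inner ℝ y ξ) : ℂ) * (cosTransform g ξ : ℂ) *
      (starRingEnd ℂ) ((𝐞 (-inner ℝ z ξ) : ℂ) * (cosTransform χ ξ : ℂ)) =
      (𝐞 (inner ℝ ξ (z - y)) : ℂ) * ((cosTransform g ξ * cosTransform χ ξ : ℝ) : ℂ) := by
    intro ξ
    rw [map_mul, Complex.conj_ofReal, ← Circle.coe_inv_eq_conj, ← AddChar.map_neg_eq_inv, neg_neg,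
      inner_sub_right, sub_eq_neg_add, AddChar.map_add_eq_mul, Circle.coe_mul, real_inner_comm y,
      real_inner_comm z]
    push_cast; ring
  simp only [e1, e2, fourier_ofReal_eq_cosTransform hg1 hge, fourier_ofReal_eq_cosTransform hχ1 hχe,
    e3] at h
  -- The phases of the two translates combine to the character at `z - y`, and the product of
  -- transforms is even, so only the cosine remains.
  rw [integral_fourierChar_mul hm (fun ξ => by simp only [cosTransform_neg])] at h
  rw [← Complex.ofReal_inj, ← h, ← integral_complex_ofReal]
  simp

/-- Since `χ` is even the correlation is a convolution. With `integral_translates_mul` this yields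
Fourier inversion for the product of the two transforms: its transform is the correlation, which is
integrable and transforms back to the product. -/
lemma cosTransform_correlation (hg1 : Integrable g) (hge : ∀ x, g (-x) = g x)
    (hχ1 : Integrable χ) (hχe : ∀ x, χ (-x) = χ x) :
    Integrable (fun w => ∫ x, g x * χ (x - w)) ∧ ∀ ξ,
    cosTransform (fun w => ∫ x, g x * χ (x - w)) ξ = cosTransform g ξ * cosTransform χ ξ := by
  have hK : (fun w => ∫ x, g x * χ (x - w)) =
      convolution g χ (ContinuousLinearMap.mul ℝ ℝ) volume := by
    ext w
    rw [convolution_def]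
    refine integral_congr_ae (Eventually.of_forall fun x => ?_)
    simp only [ContinuousLinearMap.mul_apply']
    rw [← hχe, neg_sub]
  have hint : Integrable (fun w => ∫ x, g x * χ (x - w)) := by
    rw [hK]; exact hg1.integrable_convolution _ hχ1
  refine ⟨hint, fun ξ => ?_⟩
  have heven : ∀ w, ∫ x, g x * χ (x - -w) = ∫ x, g x * χ (x - w) := by
    intro w
    rw [← integral_neg_eq_self]
    refine integral_congr_ae (Eventually.of_forall fun x => ?_)
    simp only
    rw [hge, ← hχe, neg_sub, sub_neg_eq_add, neg_add_eq_sub, ← neg_sub, neg_sub]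
  have hF := Real.fourier_mul_convolution_eq (hg1.ofReal (𝕜 := ℂ)) (hχ1.ofReal (𝕜 := ℂ)) ξ
  have hc : convolution (fun x => (g x : ℂ)) (fun x => (χ x : ℂ)) (ContinuousLinearMap.mul ℂ ℂ) volume
      = fun w => ((∫ x, g x * χ (x - w) : ℝ) : ℂ) := by
    ext w
    rw [congrFun hK w, convolution_def, convolution_def, ← integral_complex_ofReal]
    simp
  have hF' : 𝓕 (fun w => ((∫ x, g x * χ (x - w) : ℝ) : ℂ)) ξ =
      𝓕 (fun x => (g x : ℂ)) ξ * 𝓕 (fun x => (χ x : ℂ)) ξ := hc ▸ hF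
  rw [fourier_ofReal_eq_cosTransform hint heven, fourier_ofReal_eq_cosTransform hg1 hge,
    fourier_ofReal_eq_cosTransform hχ1 hχe] at hF'
  exact_mod_cast hF'

end Fourier

/-! ### Positive definite functions -/

section PositiveDefinite

/-- Expanding the square gives `‖v z - v y‖² = 2 K(0) - 2 K(z - y)`. -/
lemma continuous_of_inner_eq {V H : Type*} [NormedAddCommGroup V] [NormedAddCommGroup H]
    [InnerProductSpace ℝ H] {v : V → H} {K : V → ℝ} (hKc : Continuous K)
    (hK : ∀ y z, inner ℝ (v y) (v z) = K (z - y)) : Continuous v := by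
  have hn : ∀ y z, ‖v z - v y‖ ^ 2 = 2 * K 0 - 2 * K (z - y) := by
    intro y z
    rw [norm_sub_sq_real, ← real_inner_self_eq_norm_sq, ← real_inner_self_eq_norm_sq,
      real_inner_comm (v y) (v z), hK, hK, hK, sub_self, sub_self]
    ring
  refine continuous_iff_continuousAt.2 fun y => ?_
  rw [ContinuousAt, tendsto_iff_norm_sub_tendsto_zero]
  have h1 : Tendsto (fun z => Real.sqrt (2 * K 0 - 2 * K (z - y))) (𝓝 y) (𝓝 0) := by
    have : Continuous fun z => Real.sqrt (2 * K 0 - 2 * K (z - y)) := by fun_prop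
    simpa using this.tendsto y
  refine h1.congr fun z => ?_
  rw [← hn, Real.sqrt_sq (norm_nonneg _)]

variable {V : Type*} [NormedAddCommGroup V] [InnerProductSpace ℝ V] [FiniteDimensional ℝ V]
  [MeasurableSpace V] [BorelSpace V]
  {H : Type*} [NormedAddCommGroup H] [InnerProductSpace ℝ H]

lemma integrable_exp_neg_mul_sq_norm {ε : ℝ} (hε : 0 < ε) :
    Integrable fun y : V => Real.exp (-ε * ‖y‖ ^ 2) := by
  have := (GaussianFourier.integrable_cexp_neg_mul_sq_norm_add (V := V) (b := (ε : ℂ))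
    (by simpa using hε) 0 0).re
  refine this.congr (Eventually.of_forall fun y => ?_)
  have e : -(ε : ℂ) * (‖y‖ : ℂ) ^ 2 + 0 * ((inner ℝ (0 : V) y : ℝ) : ℂ) =
      ((-ε * ‖y‖ ^ 2 : ℝ) : ℂ) := by push_cast; ring
  simp only [e]
  exact Complex.exp_ofReal_re _

variable [CompleteSpace H]

/-- The double integral is `‖∫ h(y) v(y) dy‖²`. -/
lemma double_integral_nonneg {v : V → H} {K : V → ℝ} (hKc : Continuous K)
    (hK : ∀ y z, inner ℝ (v y) (v z) = K (z - y)) {h : V → ℝ} (hh : Integrable h) :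
    0 ≤ ∫ y, ∫ z, h y * h z * K (z - y) := by
  have hv := continuous_of_inner_eq hKc hK
  have hvn : ∀ y, ‖v y‖ = Real.sqrt (K 0) := by
    intro y
    rw [norm_eq_sqrt_real_inner, hK, sub_self]
  have hI : Integrable fun y => h y • v y := by
    refine hh.smul_bdd (Real.sqrt (K 0)) hv.aestronglyMeasurable ?_
    exact Eventually.of_forall fun y => (hvn y).le
  have h0 : (0 : ℝ) ≤ inner ℝ (∫ y, h y • v y) (∫ y, h y • v y) := real_inner_self_nonneg
  rw [← integral_inner hI] at h0
  convert h0 using 1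
  refine integral_congr_ae (Eventually.of_forall fun y => ?_)
  simp only
  rw [real_inner_comm, ← integral_inner hI]
  refine integral_congr_ae (Eventually.of_forall fun z => ?_)
  simp only
  rw [real_inner_smul_left, real_inner_smul_right, ← hK]
  ring

/-- The cosine transform of a continuous integrable positive definite function is nonnegative. -/
lemma cosTransform_nonneg_of_inner_eq {v : V → H} {K : V → ℝ} (hKc : Continuous K)
    (hKi : Integrable K) (hK : ∀ y z, inner ℝ (v y) (v z) = K (z - y)) (ξ : V) :
    0 ≤ cosTransform K ξ := by
  have hKb : ∀ w, ‖K w‖ ≤ K 0 := by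
    intro w
    have h1 : K w = inner ℝ (v 0) (v w) := by rw [hK, sub_zero]
    have h2 : ∀ y, ‖v y‖ ^ 2 = K 0 := fun y => by rw [← real_inner_self_eq_norm_sq, hK, sub_self]
    rw [h1]
    refine (norm_inner_le_norm _ _).trans ?_
    have := two_mul_le_add_sq ‖v 0‖ ‖v w‖
    rw [h2, h2] at this
    linarith
  -- Positivity is proved under a Gaussian window of width tending to infinity, which is then
  -- removed by dominated convergence.
  have hε : ∀ ε : ℝ, 0 < ε →
      0 ≤ ∫ w, Real.exp (-(ε / 2) * ‖w‖ ^ 2) * (K w * Real.cos (2 * Real.pi * inner ℝ w ξ)) := by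
    intro ε hε
    have hgi := integrable_exp_neg_mul_sq_norm (V := V) hε
    set γ : V → ℝ := fun y => Real.exp (-ε * ‖y‖ ^ 2)
    -- Testing with the Gaussian times cosine and times sine and adding leaves `cos(2π⟨z - y, ξ⟩)`,
    -- which depends only on the difference.
    have hc := double_integral_nonneg hKc hK (integrable_mul_cos hgi ξ)
    have hs := double_integral_nonneg hKc hK (integrable_mul_sin hgi ξ)
    have hslice : ∀ f : V → ℝ, Integrable f → ∀ y, Integrable fun z => f y * f z * K (z - y) := by
      intro f hf y
      refine (hf.const_mul (f y)).mul_bdd (c := K 0) ?_ (Eventually.of_forall fun z => hKb _)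
      exact (hKc.comp (continuous_id.sub continuous_const)).aestronglyMeasurable
    have hprod : ∀ f : V → ℝ, Integrable f →
        Integrable fun y => ∫ z, f y * f z * K (z - y) := by
      intro f hf
      have : Integrable (fun p : V × V => f p.1 * f p.2 * K (p.2 - p.1)) (volume.prod volume) := by
        refine (hf.mul_prod hf).mul_bdd (c := K 0) ?_ (Eventually.of_forall fun z => hKb _)
        exact (hKc.comp (continuous_snd.sub continuous_fst)).aestronglyMeasurable
      exact this.integral_prod_left
    have hsum := add_nonneg hc hs
    rw [← integral_add (hprod _ (integrable_mul_cos hgi ξ)) (hprod _ (integrable_mul_sin hgi ξ))]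
      at hsum
    have e1 : ∀ y, (∫ z, γ y * Real.cos (2 * Real.pi * inner ℝ y ξ) *
          (γ z * Real.cos (2 * Real.pi * inner ℝ z ξ)) * K (z - y)) +
        (∫ z, γ y * Real.sin (2 * Real.pi * inner ℝ y ξ) *
          (γ z * Real.sin (2 * Real.pi * inner ℝ z ξ)) * K (z - y)) =
        ∫ w, γ y * γ (w + y) * (K w * Real.cos (2 * Real.pi * inner ℝ w ξ)) := by
      intro y
      rw [← integral_add (hslice _ (integrable_mul_cos hgi ξ) y)
        (hslice _ (integrable_mul_sin hgi ξ) y), ← integral_add_right_eq_self _ y]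
      refine integral_congr_ae (Eventually.of_forall fun w => ?_)
      simp only [add_sub_cancel_right, inner_add_left, mul_add]
      have := Real.cos_sub (2 * Real.pi * inner ℝ w ξ + 2 * Real.pi * inner ℝ y ξ)
        (2 * Real.pi * inner ℝ y ξ)
      rw [add_sub_cancel_right] at this
      rw [this]
      ring
    simp only [e1] at hsum
    have hF : Integrable (fun p : V × V => γ p.1 * γ (p.2 + p.1) *
        (K p.2 * Real.cos (2 * Real.pi * inner ℝ p.2 ξ))) (volume.prod volume) := by
      have h1 := hgi.mul_prod (integrable_mul_cos hKi ξ)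
      have h2 := h1.bdd_mul (c := 1) (f := fun p : V × V => γ (p.2 + p.1))
        (by
          have : Continuous fun p : V × V => γ (p.2 + p.1) := by fun_prop
          exact this.aestronglyMeasurable)
        (Eventually.of_forall fun p => by
          simp only [γ, Real.norm_eq_abs, Real.abs_exp, Real.exp_le_one_iff]
          have := sq_nonneg ‖p.2 + p.1‖
          nlinarith)
      refine h2.congr (Eventually.of_forall fun p => ?_)
      simp only
      ring
    rw [integral_integral_swap hF] at hsum
    have e2 : ∀ w : V, ∫ y, γ y * γ (w + y) * (K w * Real.cos (2 * Real.pi * inner ℝ w ξ)) =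
        (∫ u : V, Real.exp (-(2 * ε) * ‖u‖ ^ 2)) *
          (Real.exp (-(ε / 2) * ‖w‖ ^ 2) * (K w * Real.cos (2 * Real.pi * inner ℝ w ξ))) := by
      intro w
      -- Centring at the midpoint, the parallelogram law separates the variables: `‖u - w/2‖² + ‖u +
      -- w/2‖² = 2‖u‖² + ‖w‖²/2`. The `u` integral is then a positive constant.
      have e3 : ∀ u : V, γ (u + -((1 / 2 : ℝ) • w)) * γ (w + (u + -((1 / 2 : ℝ) • w))) =
          Real.exp (-(2 * ε) * ‖u‖ ^ 2) * Real.exp (-(ε / 2) * ‖w‖ ^ 2) := by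
        intro u
        simp only [γ]
        rw [← Real.exp_add, ← Real.exp_add]
        congr 1
        have h1 := parallelogram_law_with_norm ℝ u ((1 / 2 : ℝ) • w)
        have h2 : w + (u + -((1 / 2 : ℝ) • w)) = u + (1 / 2 : ℝ) • w := by module
        have h3 : ‖(1 / 2 : ℝ) • w‖ = ‖w‖ / 2 := by
          rw [norm_smul]; norm_num; ring
        rw [h3] at h1
        rw [h2, ← sub_eq_add_neg]
        linear_combination (-ε) * h1
      rw [integral_mul_const, ← integral_add_right_eq_self _ (-((1 / 2 : ℝ) • w))]
      simp only [e3]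
      rw [integral_mul_const]
      ring
    simp only [e2] at hsum
    rw [integral_const_mul] at hsum
    refine nonneg_of_mul_nonneg_right hsum ?_
    exact integral_exp_pos (integrable_exp_neg_mul_sq_norm (by positivity))
  have hlim : Tendsto (fun n : ℕ => ∫ w, Real.exp (-((1 / ((n : ℝ) + 1)) / 2) * ‖w‖ ^ 2) *
      (K w * Real.cos (2 * Real.pi * inner ℝ w ξ))) atTop (𝓝 (cosTransform K ξ)) := by
    refine tendsto_integral_of_dominated_convergence (fun w => ‖K w‖) (fun n => ?_) hKi.norm
      (fun n => Eventually.of_forall fun w => ?_) (Eventually.of_forall fun w => ?_)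
    · exact (Continuous.aestronglyMeasurable (by fun_prop)).mul
        (integrable_mul_cos hKi ξ).aestronglyMeasurable
    · rw [norm_mul, norm_mul, Real.norm_eq_abs, Real.abs_exp]
      have h1 : Real.exp (-((1 / ((n : ℝ) + 1)) / 2) * ‖w‖ ^ 2) ≤ 1 := by
        rw [Real.exp_le_one_iff]
        have : 0 ≤ 1 / ((n : ℝ) + 1) / 2 * ‖w‖ ^ 2 := by positivity
        linarith
      have h2 := Real.abs_cos_le_one (2 * Real.pi * inner ℝ w ξ)
      calc _ ≤ 1 * (‖K w‖ * 1) := by gcongr; exact h2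
        _ = _ := by ring
    · have h1 : Tendsto (fun n : ℕ => -((1 / ((n : ℝ) + 1)) / 2) * ‖w‖ ^ 2) atTop (𝓝 0) := by
        have := ((tendsto_one_div_add_atTop_nhds_zero_nat (𝕜 := ℝ)).div_const 2).neg.mul_const
          (‖w‖ ^ 2)
        simpa using this
      have := ((Real.continuous_exp.tendsto 0).comp h1).mul_const
        (K w * Real.cos (2 * Real.pi * inner ℝ w ξ))
      simpa using this
  exact ge_of_tendsto' hlim fun n => hε _ (by positivity)

end PositiveDefinite

/-! ### Function spaces from feature maps -/

section FeatureMap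

variable {E T L : Type} [MeasureSpace E] [NormedAddCommGroup L] [InnerProductSpace ℝ L]
  [CompleteSpace L]

/-- A feature map `v` into a Hilbert space and a family of functions `h` with the same linear
relations give a Hilbert space of functions spanned by the `h y`. -/
lemma isAveragingKernel_of_featureMap {ω : T → Set E} {A : E → T → ℝ} (v : T → L)
    (h : T → (E →ₘ[volume] ℝ)) (hA : ∀ τ, h τ =ᵐ[volume] fun x => A x τ)
    (hker : ∀ c : T →₀ ℝ, Finsupp.linearCombination ℝ v c = 0 ↔
      Finsupp.linearCombination ℝ h c = 0)
    (hint : ∀ y τ, IntegrableOn (h y) (ω τ))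
    (havg : ∀ y τ, ⨍ x in ω τ, h y x = inner ℝ (v y) (v τ)) : IsAveragingKernel ω A := by
  set φ := Finsupp.linearCombination ℝ v
  set ψ := Finsupp.linearCombination ℝ h
  have hk : LinearMap.ker φ ≤ LinearMap.ker ψ := fun c hc =>
    LinearMap.mem_ker.2 ((hker c).1 (LinearMap.mem_ker.1 hc))
  -- The function attached to the vector `φ c` is `ψ c`. One direction of `hker` makes this well
  -- defined, the other gives injectivity in `hinj`.
  let t : LinearMap.range φ →ₗ[ℝ] (E →ₘ[volume] ℝ) :=
    ((LinearMap.ker φ).liftQ ψ hk).comp φ.quotKerEquivRange.symm.toLinearMap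
  have ht : ∀ c, t ⟨φ c, c, rfl⟩ = ψ c := by
    intro c
    have : φ.quotKerEquivRange.symm ⟨φ c, c, rfl⟩ = (LinearMap.ker φ).mkQ c := by
      rw [LinearEquiv.symm_apply_eq]
      ext
      simp
    simp only [t, LinearMap.comp_apply, LinearEquiv.coe_coe, this]
    simp
  -- The Hilbert space is the closed span of the feature vectors. Only the span itself, the core,
  -- consists of functions.
  let S := (LinearMap.range φ).topologicalClosure
  let core : Submodule ℝ S := (LinearMap.range φ).comap S.subtype
  let ρ : core →ₗ[ℝ] LinearMap.range φ := (S.subtype.comp core.subtype).codRestrict _ fun x => x.2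
  have hcore : ∀ f : core, ∃ c, ((f : S) : L) = φ c ∧ t (ρ f) = ψ c := by
    intro f
    obtain ⟨c, hc⟩ := f.2
    refine ⟨c, hc.symm, ?_⟩
    rw [← ht c]
    congr 1
    exact Subtype.ext hc.symm
  have hinj : Function.Injective (t.comp ρ) := by
    rw [← LinearMap.ker_eq_bot, LinearMap.ker_eq_bot']
    intro f hf
    obtain ⟨c, hc, hc'⟩ := hcore f
    have : ψ c = 0 := hc'.symm.trans hf
    rw [(hker c).2 this] at hc
    exact Subtype.ext (Subtype.ext hc)
  have hdense : Dense (core : Set S) := by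
    intro x
    rw [closure_subtype]
    have hx : (x : L) ∈ closure (LinearMap.range φ : Set L) := x.2
    refine closure_mono ?_ hx
    intro y hy
    exact ⟨⟨y, subset_closure hy⟩, hy, rfl⟩
  have : CompleteSpace S := (Submodule.isClosed_topologicalClosure _).completeSpace_coe
  have hpsi : ∀ (c : T →₀ ℝ) (τ : T), IntegrableOn (ψ c) (ω τ) ∧
      ⨍ x in ω τ, ψ c x = inner ℝ (φ c) (v τ) := by
    intro c τ
    induction c using Finsupp.induction_linear with
    | zero =>
      have h0 : ψ 0 =ᵐ[volume.restrict (ω τ)] (0 : E → ℝ) := by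
        rw [map_zero]; exact ae_restrict_of_ae AEEqFun.coeFn_zero
      refine ⟨(integrable_zero _ _ _).congr h0.symm, ?_⟩
      rw [map_zero φ, inner_zero_left, setAverage_eq, integral_congr_ae h0]
      simp
    | add f g hf hg =>
      have h0 : ψ (f + g) =ᵐ[volume.restrict (ω τ)] (ψ f + ψ g : E → ℝ) := by
        rw [map_add]; exact ae_restrict_of_ae (AEEqFun.coeFn_add _ _)
      refine ⟨(hf.1.add hg.1).congr h0.symm, ?_⟩
      rw [map_add φ, inner_add_left, ← hf.2, ← hg.2, setAverage_eq, setAverage_eq, setAverage_eq,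
        integral_congr_ae h0, ← smul_add, ← integral_add hf.1 hg.1]
      rfl
    | single y r =>
      have h0 : ψ (Finsupp.single y r) =ᵐ[volume.restrict (ω τ)] (r • h y : E → ℝ) := by
        simp only [ψ, Finsupp.linearCombination_single]
        exact ae_restrict_of_ae (AEEqFun.coeFn_smul _ _)
      refine ⟨((hint y τ).smul r).congr h0.symm, ?_⟩
      simp only [φ, Finsupp.linearCombination_single]
      rw [real_inner_smul_left, ← havg, setAverage_eq, setAverage_eq, integral_congr_ae h0]
      simp only [Pi.smul_apply, smul_eq_mul]
      rw [integral_const_mul]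
      ring
  let X : FunctionHilbertSpace E :=
    { H := S, core := core, dense_core := hdense, toFun := t.comp ρ, toFun_injective := hinj }
  have hφv : ∀ τ, φ (Finsupp.single τ 1) = v τ := fun τ => by simp [φ]
  have hψh : ∀ τ, ψ (Finsupp.single τ 1) = h τ := fun τ => by simp [ψ]
  have hvmem : ∀ τ, v τ ∈ LinearMap.range φ := fun τ => ⟨_, hφv τ⟩
  let vS : T → S := fun τ => ⟨v τ, subset_closure (hvmem τ)⟩
  refine ⟨X, fun f τ => ?_, fun τ => innerSL ℝ (vS τ), fun τ f => ?_, fun τ => ?_⟩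
  · obtain ⟨c, hc, hc'⟩ := hcore f
    change IntegrableOn (t (ρ f)) (ω τ)
    rw [hc']
    exact (hpsi c τ).1
  · obtain ⟨c, hc, hc'⟩ := hcore f
    change inner ℝ (v τ) ((f : S) : L) = ⨍ x in ω τ, (t (ρ f)) x
    rw [hc', hc, (hpsi c τ).2, real_inner_comm]
  · refine ⟨⟨vS τ, hvmem τ⟩, ?_, fun f => real_inner_comm _ _⟩
    have : t (ρ ⟨vS τ, hvmem τ⟩) = h τ := by
      rw [← hψh τ, ← ht]
      congr 1
      exact Subtype.ext (hφv τ).symm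
    change t (ρ ⟨vS τ, hvmem τ⟩) =ᵐ[volume] fun x => A x τ
    rw [this]
    exact hA τ

end FeatureMap

/-! ### Averaging kernels and positivity of the Fourier transform -/

section Averaging

variable {d : ℕ}

local notation "𝔼" => EuclideanSpace ℝ (Fin d)

lemma image_add_closedBall (y : 𝔼) (a : ℝ) :
    (fun x => y + x) '' Metric.closedBall 0 a = Metric.closedBall y a := by
  simp

/-- Averages over translated balls become correlations with the indicator of one ball, the form used
on the Fourier side. -/
lemma setAverage_closedBall (y : 𝔼) (a : ℝ) (f : 𝔼 → ℝ) :
    ⨍ x in Metric.closedBall y a, f x = (volume.real (Metric.closedBall (0 : 𝔼) a))⁻¹ *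
      ∫ x, f x * (Metric.closedBall (0 : 𝔼) a).indicator 1 (x - y) := by
  have h1 : volume.real (Metric.closedBall y a) = volume.real (Metric.closedBall (0 : 𝔼) a) := by
    rw [measureReal_def, measureReal_def, Measure.addHaar_closedBall_center]
  rw [setAverage_eq, h1, smul_eq_mul, ← integral_indicator measurableSet_closedBall]
  congr 2
  ext x
  by_cases hx : x ∈ Metric.closedBall y a
  · have : x - y ∈ Metric.closedBall (0 : 𝔼) a := by simpa [dist_eq_norm] using hx
    rw [indicator_of_mem hx, indicator_of_mem this]; simp
  · have : x - y ∉ Metric.closedBall (0 : 𝔼) a := by simpa [dist_eq_norm] using hx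
    rw [indicator_of_notMem hx, indicator_of_notMem this]; simp

lemma ballIndicator_neg (a : ℝ) (x : 𝔼) :
    (Metric.closedBall (0 : 𝔼) a).indicator (1 : 𝔼 → ℝ) (-x) =
      (Metric.closedBall (0 : 𝔼) a).indicator 1 x := by
  simp [indicator]

lemma integrable_ballIndicator (a : ℝ) :
    Integrable ((Metric.closedBall (0 : 𝔼) a).indicator (1 : 𝔼 → ℝ)) :=
  (integrable_indicator_iff measurableSet_closedBall).2
    (integrableOn_const measure_closedBall_lt_top.ne)

lemma memLp_ballIndicator (a : ℝ) :
    MemLp ((Metric.closedBall (0 : 𝔼) a).indicator (1 : 𝔼 → ℝ)) 2 :=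
  memLp_indicator_const 2 measurableSet_closedBall 1 (Or.inr measure_closedBall_lt_top.ne)

lemma volume_real_closedBall_pos {a : ℝ} (ha : 0 < a) :
    0 < volume.real (Metric.closedBall (0 : 𝔼) a) :=
  ENNReal.toReal_pos (Metric.measure_closedBall_pos volume 0 ha).ne' measure_closedBall_lt_top.ne

variable {g : EuclideanSpace ℝ (Fin d) → ℝ} {a : ℝ}

/-- If the translates of `g` form an averaging kernel for the translates of a ball, then the
product of the Fourier transforms of `g` and of the ball is nonnegative. -/
lemma cosTransform_mul_nonneg_of_isUniformAveragingKernel (ha : 0 < a) (hg1 : Integrable g)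
    (hg2 : MemLp g 2) (hge : ∀ x, g (-x) = g x)
    (h : IsUniformAveragingKernel (Metric.closedBall 0 a) (fun x y => g (x - y))) (ξ : 𝔼) :
    0 ≤ cosTransform g ξ * cosTransform ((Metric.closedBall (0 : 𝔼) a).indicator 1) ξ := by
  obtain ⟨X, -, lam, hlam, hrep⟩ := h
  choose k hk hk' using hrep
  set χ : 𝔼 → ℝ := (Metric.closedBall (0 : 𝔼) a).indicator 1
  set c := (volume.real (Metric.closedBall (0 : 𝔼) a))⁻¹
  have hc : 0 < c := inv_pos.2 (volume_real_closedBall_pos ha)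
  have hcorr := integral_translates_mul hg1 hg2 hge (integrable_ballIndicator a)
    (memLp_ballIndicator a) (ballIndicator_neg a)
  set m : 𝔼 → ℝ := fun ξ => cosTransform g ξ * cosTransform χ ξ
  have hm : Integrable m := (memLp_cosTransform hg1 hg2 hge).integrable_mul
    (memLp_cosTransform (integrable_ballIndicator a) (memLp_ballIndicator a) (ballIndicator_neg a))
  obtain ⟨hi, hcos⟩ := cosTransform_correlation hg1 hge (integrable_ballIndicator a)
    (ballIndicator_neg a)
  have h0 : (fun w => ∫ x, g x * χ (x - w)) = cosTransform m := by
    ext w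
    simpa using hcorr 0 w
  rw [h0] at hi
  have hlam' : ∀ τ (f : X.core), lam τ f = ⨍ x in Metric.closedBall τ a, X.toFun f x :=
    fun τ f => (hlam τ f).trans (by simp only [image_add_closedBall])
  have hcos' : ∀ ξ, cosTransform (cosTransform m) ξ = m ξ := by
    rw [← h0]; exact hcos
  -- The vector `k z` represents the average over the ball about `z`, so pairing it with `k y`
  -- averages `g(· - y)` there.
  have hK : ∀ y z, inner ℝ (k y : X.H) (k z : X.H) = c * cosTransform m (z - y) := by
    intro y z
    rw [← hk' z, hlam', ← hcorr y z,
      average_congr (ae_restrict_of_ae (hk y)), setAverage_closedBall]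
  have hpos := cosTransform_nonneg_of_inner_eq (v := fun y => (k y : X.H))
    (K := fun w => c * cosTransform m w)
    (continuous_const.mul (continuous_cosTransform hm)) (hi.const_mul c) hK ξ
  have e : cosTransform (fun w => c * cosTransform m w) ξ = c * m ξ := by
    rw [← hcos' ξ, cosTransform, cosTransform, ← integral_const_mul]
    simp only [mul_assoc]
  rw [e] at hpos
  exact nonneg_of_mul_nonneg_right hpos hc

/-- If the product of the Fourier transforms of `g` and of a ball is nonnegative, then the
translates of `g` form an averaging kernel for the translates of the ball. -/
lemma isUniformAveragingKernel_of_cosTransform_mul_nonneg (ha : 0 < a) (hg1 : Integrable g)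
    (hg2 : MemLp g 2) (hge : ∀ x, g (-x) = g x)
    (hpos : ∀ ξ, 0 ≤ cosTransform g ξ *
      cosTransform ((Metric.closedBall (0 : 𝔼) a).indicator 1) ξ)
    (hne : ∀ᵐ ξ, cosTransform ((Metric.closedBall (0 : 𝔼) a).indicator 1) ξ ≠ 0) :
    IsUniformAveragingKernel (Metric.closedBall 0 a) (fun x y => g (x - y)) := by
  set χ : 𝔼 → ℝ := (Metric.closedBall (0 : 𝔼) a).indicator 1
  set c := (volume.real (Metric.closedBall (0 : 𝔼) a))⁻¹
  have hc : 0 < c := inv_pos.2 (volume_real_closedBall_pos ha)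
  have hcorr := integral_translates_mul hg1 hg2 hge (integrable_ballIndicator a)
    (memLp_ballIndicator a) (ballIndicator_neg a)
  set m : 𝔼 → ℝ := fun ξ => cosTransform g ξ * cosTransform χ ξ
  have hm : Integrable m := (memLp_cosTransform hg1 hg2 hge).integrable_mul
    (memLp_cosTransform (integrable_ballIndicator a) (memLp_ballIndicator a) (ballIndicator_neg a))
  have hmc : Continuous m := (continuous_cosTransform hg1).mul
    (continuous_cosTransform (integrable_ballIndicator a))
  have tr (y : 𝔼) : MeasurePreserving (fun x : 𝔼 => x - y) volume volume :=
    measurePreserving_sub_right volume y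
  -- the feature map
  let e : 𝔼 → 𝔼 → ℂ := fun y ξ => (𝐞 (-inner ℝ y ξ) : ℂ)
  have hec : ∀ y, Continuous (e y) := fun y => by
    have : Continuous fun ξ : 𝔼 => -inner ℝ y ξ := by fun_prop
    exact continuous_subtype_val.comp (Real.continuous_fourierChar.comp this)
  have hen : ∀ y ξ, ‖e y ξ‖ = 1 := fun y ξ => Circle.norm_coe _
  let f : 𝔼 → 𝔼 → ℂ := fun y ξ => e y ξ * (Real.sqrt (c * m ξ) : ℂ)
  have hfL : ∀ y, MemLp (f y) 2 := by
    intro y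
    have hfc : Continuous (f y) := (hec y).mul (by fun_prop)
    rw [memLp_two_iff_integrable_sq_norm hfc.aestronglyMeasurable]
    refine (hm.const_mul c).congr (Eventually.of_forall fun ξ => ?_)
    simp only [f]
    rw [norm_mul, hen, one_mul, Complex.norm_real, Real.norm_of_nonneg (Real.sqrt_nonneg _),
      Real.sq_sqrt (mul_nonneg hc.le (hpos ξ))]
  -- The complex `L²` space serves as a real Hilbert space. Its inner product is the real part, so
  -- `⟨v y, v τ⟩` is `c` times the cosine transform of `m` at `τ - y`.
  let v : 𝔼 → Lp ℂ 2 (volume : Measure 𝔼) := fun y => (hfL y).toLp (f y)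
  let h : 𝔼 → (𝔼 →ₘ[volume] ℝ) := fun y =>
    AEEqFun.mk (fun x => g (x - y)) (hg2.comp_measurePreserving (tr y)).aestronglyMeasurable
  have hh : ∀ y, h y =ᵐ[volume] fun x => g (x - y) := fun y => AEEqFun.coeFn_mk _ _
  refine isAveragingKernel_of_featureMap v h hh ?_ ?_ ?_
  -- A linear combination has one trigonometric polynomial `p` for both sides: the feature vector is
  -- `p √(c m)`, and the function has Fourier transform `p ĝ`. As `m = ĝ χ̂` and `χ̂ ≠ 0` almost
  -- everywhere, the two vanish together.
  · have hrepr : ∀ b : 𝔼 →₀ ℝ, ∃ (p : 𝔼 → ℂ) (F : 𝔼 → ℝ), Integrable F ∧ MemLp F 2 ∧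
        (Finsupp.linearCombination ℝ v b =ᵐ[volume] fun ξ => p ξ * (Real.sqrt (c * m ξ) : ℂ)) ∧
        (Finsupp.linearCombination ℝ h b =ᵐ[volume] F) ∧
        ∀ ξ, 𝓕 (fun x => (F x : ℂ)) ξ = p ξ * (cosTransform g ξ : ℂ) := by
      intro b
      induction b using Finsupp.induction_linear with
      | zero =>
        refine ⟨0, 0, integrable_zero _ _ _, MemLp.zero, ?_, ?_, fun ξ => ?_⟩
        · rw [map_zero]
          filter_upwards [Lp.coeFn_zero ℂ 2 (volume : Measure 𝔼)] with ξ hξ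
          simp
        · rw [map_zero]; exact AEEqFun.coeFn_zero
        · simp [Real.fourier_eq]
      | add b₁ b₂ h₁ h₂ =>
        obtain ⟨p₁, F₁, i₁, j₁, k₁, l₁, m₁⟩ := h₁
        obtain ⟨p₂, F₂, i₂, j₂, k₂, l₂, m₂⟩ := h₂
        refine ⟨p₁ + p₂, F₁ + F₂, i₁.add i₂, j₁.add j₂, ?_, ?_, fun ξ => ?_⟩
        · rw [map_add]
          filter_upwards [Lp.coeFn_add (Finsupp.linearCombination ℝ v b₁)
            (Finsupp.linearCombination ℝ v b₂), k₁, k₂] with ξ e₁ e₂ e₃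
          rw [e₁, Pi.add_apply, e₂, e₃, Pi.add_apply, add_mul]
        · rw [map_add]
          filter_upwards [AEEqFun.coeFn_add (Finsupp.linearCombination ℝ h b₁)
            (Finsupp.linearCombination ℝ h b₂), l₁, l₂] with x e₁ e₂ e₃
          rw [e₁, Pi.add_apply, e₂, e₃, Pi.add_apply]
        · rw [Pi.add_apply, add_mul, ← m₁, ← m₂, Real.fourier_eq, Real.fourier_eq, Real.fourier_eq,
            ← integral_add ((Real.fourierIntegral_convergent_iff ξ).2 i₁.ofReal)
              ((Real.fourierIntegral_convergent_iff ξ).2 i₂.ofReal)]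
          simp
      | single y r =>
        refine ⟨fun ξ => r * e y ξ, fun x => r * g (x - y), (hg1.comp_sub_right y).const_mul r,
          (hg2.comp_measurePreserving (tr y)).const_mul r, ?_, ?_, fun ξ => ?_⟩
        · rw [Finsupp.linearCombination_single]
          filter_upwards [Lp.coeFn_smul r (v y), (hfL y).coeFn_toLp] with ξ e₁ e₂
          rw [e₁, Pi.smul_apply, e₂, Complex.real_smul, mul_assoc]
        · rw [Finsupp.linearCombination_single]
          filter_upwards [AEEqFun.coeFn_smul r (h y), hh y] with x e₁ e₂
          rw [e₁, Pi.smul_apply, e₂, smul_eq_mul]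
        · have e₁ := fourier_comp_sub (fun x => (g x : ℂ)) y ξ
          rw [fourier_ofReal_eq_cosTransform hg1 hge] at e₁
          rw [mul_assoc, ← e₁, Real.fourier_eq, Real.fourier_eq, ← integral_const_mul]
          simp [Circle.smul_def, mul_left_comm]
    intro b
    obtain ⟨p, F, hF1, hF2, hφ, hψ, hpF⟩ := hrepr b
    have hφ0 : Finsupp.linearCombination ℝ v b = 0 ↔
        ∀ᵐ ξ, p ξ * (Real.sqrt (c * m ξ) : ℂ) = 0 := by
      rw [Lp.eq_zero_iff_ae_eq_zero]
      exact ⟨fun H => hφ.symm.trans H, fun H => hφ.trans H⟩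
    have hψ0 : Finsupp.linearCombination ℝ h b = 0 ↔ F =ᵐ[volume] 0 :=
      ⟨fun H => hψ.symm.trans (H ▸ AEEqFun.coeFn_zero),
        fun H => AEEqFun.ext ((hψ.trans H).trans AEEqFun.coeFn_zero.symm)⟩
    rw [hφ0, hψ0]
    constructor
    · intro H
      have h1 : ∀ᵐ ξ, 𝓕 (fun x => (F x : ℂ)) ξ = 0 := by
        filter_upwards [H, hne] with ξ h2 h3
        rw [hpF]
        rcases mul_eq_zero.1 h2 with h4 | h4
        · rw [h4, zero_mul]
        · have h5 : c * m ξ = 0 :=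
            (Real.sqrt_eq_zero (mul_nonneg hc.le (hpos ξ))).1 (by exact_mod_cast h4)
          rcases mul_eq_zero.1 ((mul_eq_zero.1 h5).resolve_left hc.ne') with h6 | h6
          · rw [h6]; simp
          · exact absurd h6 h3
      have hF2' : MemLp (fun x : 𝔼 => (F x : ℂ)) 2 volume := hF2.ofReal (K := ℂ)
      have h2 : (𝓕 (hF2'.toLp (fun x => (F x : ℂ))) : Lp ℂ 2 (volume : Measure 𝔼)) = 0 := by
        rw [Lp.eq_zero_iff_ae_eq_zero]
        exact (fourier_toLp_ae_eq hF1.ofReal hF2').trans h1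
      have h3 : (hF2'.toLp (fun x => (F x : ℂ)) : Lp ℂ 2 (volume : Measure 𝔼)) = 0 := by
        rw [← norm_eq_zero, ← Lp.norm_fourier_eq, h2, norm_zero]
      have h4 := hF2'.coeFn_toLp.symm.trans ((Lp.eq_zero_iff_ae_eq_zero).1 h3)
      filter_upwards [h4] with x hx
      simpa using hx
    · intro H
      refine Eventually.of_forall fun ξ => ?_
      have h1 : 𝓕 (fun x => (F x : ℂ)) ξ = 0 := by
        rw [Real.fourier_congr_ae (f₂ := fun _ => 0) (H.mono fun x hx => by simp [hx]),
          Real.fourier_eq]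
        simp
      rw [hpF] at h1
      rcases mul_eq_zero.1 h1 with h2 | h2
      · rw [h2, zero_mul]
      · have h3 : cosTransform g ξ = 0 := by exact_mod_cast h2
        simp [m, h3]
  · intro y τ
    exact ((hg1.comp_sub_right y).congr (hh y).symm).integrableOn
  · intro y τ
    rw [image_add_closedBall, average_congr (ae_restrict_of_ae (hh y)), setAverage_closedBall,
      hcorr y τ, L2.inner_def, cosTransform, ← integral_const_mul]
    refine integral_congr_ae ?_
    filter_upwards [(hfL y).coeFn_toLp, (hfL τ).coeFn_toLp] with ξ h1 h2
    rw [h1, h2, Complex.inner]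
    have hs := Real.mul_self_sqrt (mul_nonneg hc.le (hpos ξ))
    simp only [f, e]
    rw [fourierChar_eq_cos_add_sin, fourierChar_eq_cos_add_sin, inner_sub_right,
      real_inner_comm y ξ, real_inner_comm τ ξ]
    set s := Real.sqrt (c * m ξ)
    have h3 := Real.cos_sub (2 * Real.pi * -inner ℝ y ξ) (2 * Real.pi * -inner ℝ τ ξ)
    rw [show 2 * Real.pi * -inner ℝ y ξ - 2 * Real.pi * -inner ℝ τ ξ =
      2 * Real.pi * (inner ℝ τ ξ - inner ℝ y ξ) by ring] at h3
    rw [h3]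
    simp only [map_mul, map_add, Complex.conj_ofReal, Complex.conj_I, Complex.mul_re,
      Complex.mul_im, Complex.add_re, Complex.add_im, Complex.ofReal_re, Complex.ofReal_im,
      Complex.I_re, Complex.I_im, Complex.neg_re, Complex.neg_im]
    rw [← mul_assoc, ← hs]
    ring

end Averaging

/-! ### The Hankel transform as a radial Fourier transform -/

section Hankel

variable {d : ℕ}

local notation "𝔼" => EuclideanSpace ℝ (Fin d)

/-- The powers of `r` cancel and those of `s` combine to the radial density `s^(d-1)`, which
exhibits the integral as a radial Fourier integral. -/
lemma truncatedHankel_eq (hd : 1 ≤ d) (β : ℝ → ℝ) (R : ℝ) {r : ℝ} (hr : 0 < r) :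
    truncatedHankel d β R r = 2 ^ (1 - (d : ℝ) / 2) *
      ∫ s in Ioc 0 R, β s * s ^ (d - 1) * besselU ((d : ℝ) / 2 - 1) (s * r) := by
  rw [truncatedHankel, ← integral_const_mul, ← integral_const_mul]
  refine setIntegral_congr_fun measurableSet_Ioc fun s hs => ?_
  have hs0 : 0 < s := hs.1
  rw [besselJ_eq (by positivity), besselU, Real.div_rpow (by positivity) (by norm_num),
    Real.mul_rpow hs0.le hr.le, Real.rpow_neg hr.le]
  have h1 : s ^ (d - 1) = s ^ ((d : ℝ) / 2) * s ^ ((d : ℝ) / 2 - 1) := by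
    rw [← Real.rpow_natCast, ← Real.rpow_add hs0, Nat.cast_sub hd]
    congr 1; push_cast; ring
  have h2 : (2 : ℝ) ^ (1 - (d : ℝ) / 2) = (2 ^ ((d : ℝ) / 2 - 1))⁻¹ := by
    rw [← Real.rpow_neg (by norm_num)]; congr 1; ring
  have h3 : r ^ ((d : ℝ) / 2 - 1) ≠ 0 := (Real.rpow_pos_of_pos hr _).ne'
  rw [h1, h2]
  field_simp

/-- The radial function `ξ ↦ (2π)^(d/2) β(2π‖ξ‖)` on `ℝ^d`. -/
noncomputable def radialLift (d : ℕ) (β : ℝ → ℝ) (ξ : EuclideanSpace ℝ (Fin d)) : ℝ :=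
  (2 * Real.pi) ^ ((d : ℝ) / 2) * β (2 * Real.pi * ‖ξ‖)

/-- The restriction of `radialLift d β` to the ball `2π‖ξ‖ ≤ R`. -/
noncomputable def truncatedLift (d : ℕ) (β : ℝ → ℝ) (R : ℝ) : EuclideanSpace ℝ (Fin d) → ℝ :=
  {ξ | 2 * Real.pi * ‖ξ‖ ≤ R}.indicator (radialLift d β)

variable {β : ℝ → ℝ}

lemma continuous_radialLift (hβ : ContinuousOn β (Ici 0)) : Continuous (radialLift d β) := by
  refine continuous_const.mul (hβ.comp_continuous (by fun_prop) fun ξ => ?_)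
  have := Real.pi_pos
  exact mem_Ici.2 (by positivity)

lemma isCompact_norm_le (R : ℝ) : IsCompact {ξ : 𝔼 | 2 * Real.pi * ‖ξ‖ ≤ R} := by
  have : {ξ : 𝔼 | 2 * Real.pi * ‖ξ‖ ≤ R} = Metric.closedBall 0 (R / (2 * Real.pi)) := by
    ext ξ
    simp [le_div_iff₀' (by positivity : 0 < 2 * Real.pi)]
  rw [this]
  exact isCompact_closedBall _ _

lemma truncatedLift_neg (R : ℝ) (ξ : 𝔼) : truncatedLift d β R (-ξ) = truncatedLift d β R ξ := by
  simp [truncatedLift, indicator, radialLift]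

lemma integrable_truncatedLift (hβ : ContinuousOn β (Ici 0)) (R : ℝ) :
    Integrable (truncatedLift d β R) :=
  (integrable_indicator_iff (isCompact_norm_le R).measurableSet).2
    ((continuous_radialLift hβ).continuousOn.integrableOn_compact (isCompact_norm_le R))

lemma memLp_truncatedLift (hβ : ContinuousOn β (Ici 0)) (R : ℝ) :
    MemLp (truncatedLift d β R) 2 := by
  rw [memLp_two_iff_integrable_sq (integrable_truncatedLift hβ R).aestronglyMeasurable]
  have h : (fun ξ => truncatedLift d β R ξ ^ 2) =
      {ξ : 𝔼 | 2 * Real.pi * ‖ξ‖ ≤ R}.indicator (fun ξ => radialLift d β ξ ^ 2) := by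
    ext ξ
    by_cases h : 2 * Real.pi * ‖ξ‖ ≤ R <;> simp [truncatedLift, h]
  rw [h]
  exact (integrable_indicator_iff (isCompact_norm_le R).measurableSet).2
    (((continuous_radialLift hβ).pow 2).continuousOn.integrableOn_compact (isCompact_norm_le R))

/-- The Fourier transform of a truncated radial function is a truncated Hankel transform. -/
lemma cosTransform_truncatedLift [NeZero d] (hβ : ContinuousOn β (Ici 0)) (R : ℝ) {x : 𝔼}
    (hx : x ≠ 0) : cosTransform (truncatedLift d β R) x = truncatedHankel d β R ‖x‖ := by
  have hd : 1 ≤ d := Nat.pos_of_ne_zero (NeZero.ne d)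
  have h2π : 0 < 2 * Real.pi := by positivity
  set f : ℝ → ℝ := fun r => {r : ℝ | 2 * Real.pi * r ≤ R}.indicator
    (fun r => (2 * Real.pi) ^ ((d : ℝ) / 2) * β (2 * Real.pi * r)) r
  have hf : ∀ ξ : 𝔼, truncatedLift d β R ξ = f ‖ξ‖ := by
    intro ξ
    by_cases h : 2 * Real.pi * ‖ξ‖ ≤ R <;> simp [truncatedLift, radialLift, f, h]
  have hint : Integrable fun ξ : 𝔼 => f ‖ξ‖ :=
    (integrable_truncatedLift hβ R).congr (Eventually.of_forall hf)
  have h1 := integral_radial_mul_cos hint ((2 * Real.pi) • x)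
  have h2 : ∀ ξ : 𝔼, truncatedLift d β R ξ * Real.cos (2 * Real.pi * inner ℝ ξ x) =
      f ‖ξ‖ * Real.cos (inner ℝ ξ ((2 * Real.pi) • x)) := by
    intro ξ
    rw [hf, real_inner_smul_right]
  rw [cosTransform, truncatedHankel_eq hd β R (norm_pos_iff.2 hx)]
  simp only [h2]
  rw [h1, norm_smul, Real.norm_of_nonneg h2π.le]
  set F : ℝ → ℝ := fun s => (Iic R).indicator
    (fun s => β s * s ^ (d - 1) * besselU ((d : ℝ) / 2 - 1) (s * ‖x‖)) s
  have h3 : ∀ r ∈ Ioi (0 : ℝ), f r * r ^ (d - 1) * besselU ((d : ℝ) / 2 - 1)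
      (r * (2 * Real.pi * ‖x‖)) =
      (2 * Real.pi) ^ ((d : ℝ) / 2) / (2 * Real.pi) ^ (d - 1) * F (2 * Real.pi * r) := by
    intro r _
    by_cases h : 2 * Real.pi * r ≤ R
    · simp only [f, F, indicator, mem_ofPred_eq, h, if_true, mem_Iic]
      have hq : (2 * Real.pi) ^ (d - 1) ≠ 0 := by positivity
      rw [mul_pow (2 * Real.pi) r, show r * (2 * Real.pi * ‖x‖) = 2 * Real.pi * r * ‖x‖ by ring]
      generalize (2 * Real.pi) ^ (d - 1) = q at hq
      field_simp
    · simp [f, F, h]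
  rw [setIntegral_congr_fun measurableSet_Ioi h3, integral_const_mul,
    integral_comp_mul_left_Ioi F 0 h2π, mul_zero]
  have h4 : ∫ s in Ioi (0 : ℝ), F s =
      ∫ s in Ioc 0 R, β s * s ^ (d - 1) * besselU ((d : ℝ) / 2 - 1) (s * ‖x‖) := by
    simp only [F]
    rw [setIntegral_indicator measurableSet_Iic, Ioi_inter_Iic]
  rw [h4, smul_eq_mul]
  have h5 : (2 * Real.pi) ^ (d - 1) * (2 * Real.pi) =
      (2 * Real.pi) ^ ((d : ℝ) / 2) * (2 * Real.pi) ^ ((d : ℝ) / 2) := by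
    rw [← pow_succ, Nat.sub_add_cancel hd, ← Real.rpow_natCast, ← Real.rpow_add h2π]
    congr 1; ring
  have h6 : (2 * Real.pi) ^ ((d : ℝ) / 2) = 2 ^ ((d : ℝ) / 2) * Real.pi ^ ((d : ℝ) / 2) :=
    Real.mul_rpow (by norm_num) Real.pi_pos.le
  have h7 : (2 : ℝ) ^ (1 - (d : ℝ) / 2) = 2 / 2 ^ ((d : ℝ) / 2) := by
    rw [Real.rpow_sub (by norm_num), Real.rpow_one]
  have p1 : (0 : ℝ) < 2 ^ ((d : ℝ) / 2) := by positivity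
  have p2 : (0 : ℝ) < Real.pi ^ ((d : ℝ) / 2) := Real.rpow_pos_of_pos Real.pi_pos _
  have p3 : (0 : ℝ) < (2 * Real.pi) ^ (d - 1) := by positivity
  have p4 := Real.pi_pos
  -- The scale factor of `radialLift`, the radial density and the substitution `s = 2πr` together
  -- cancel the `π` powers from the sphere.
  have h8 : 2 * Real.pi ^ ((d : ℝ) / 2) * ((2 * Real.pi) ^ ((d : ℝ) / 2) /
      (2 * Real.pi) ^ (d - 1) * (2 * Real.pi)⁻¹) = 2 ^ (1 - (d : ℝ) / 2) := by
    rw [div_mul_eq_mul_div, ← div_eq_mul_inv, div_div, mul_comm (2 * Real.pi) ((2 * Real.pi) ^ _),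
      h5, h6, h7]
    field_simp
  rw [← h8]
  ring

lemma ae_radialMeasure_pos : ∀ᵐ r ∂(radialMeasure d), 0 < r := by
  refine (withDensity_absolutelyContinuous _ _).ae_le ?_
  rw [← restrict_Ioi_eq_restrict_Ici]
  exact ae_restrict_mem measurableSet_Ioi

/-- For `r > 0` the transform agrees with a continuous cosine transform along a ray. -/
lemma aestronglyMeasurable_truncatedHankel [NeZero d] (hβ : ContinuousOn β (Ici 0)) (R : ℝ) :
    AEStronglyMeasurable (truncatedHankel d β R) (radialMeasure d) := by
  have hc : Continuous fun r : ℝ => cosTransform (truncatedLift d β R)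
      (r • EuclideanSpace.single (0 : Fin d) (1 : ℝ)) :=
    (continuous_cosTransform (integrable_truncatedLift hβ R)).comp
      (by fun_prop)
  refine hc.aestronglyMeasurable.congr ?_
  filter_upwards [ae_radialMeasure_pos] with r hr
  rw [cosTransform_truncatedLift hβ R (by simpa using hr.ne')]
  simp [norm_smul, abs_of_pos hr]

lemma memLp_comp_smul {f : 𝔼 → ℝ} (hf : MemLp f 2) {c : ℝ} (hc : c ≠ 0) :
    MemLp (fun x => f (c • x)) 2 := by
  have hmap := Measure.map_addHaar_smul (volume : Measure 𝔼) hc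
  refine MemLp.comp_of_map (f := fun x : 𝔼 => c • x) (g := f) ?_ (by fun_prop)
  rw [hmap]
  exact hf.smul_measure ENNReal.ofReal_ne_top

lemma memLp_radialLift_iff [NeZero d] (hβ : ContinuousOn β (Ici 0)) :
    MemLp (radialLift d β) 2 ↔ MemLp β 2 (radialMeasure d) := by
  have hm : AEStronglyMeasurable β (radialMeasure d) :=
    (hβ.aestronglyMeasurable measurableSet_Ici).mono_ac (withDensity_absolutelyContinuous _ _)
  have h2π : 0 < 2 * Real.pi := by positivity
  have hp : (2 * Real.pi) ^ ((d : ℝ) / 2) ≠ 0 := (Real.rpow_pos_of_pos h2π _).ne'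
  rw [← memLp_comp_norm_iff hm]
  constructor
  · intro h
    have := (memLp_comp_smul h (inv_ne_zero h2π.ne')).const_mul ((2 * Real.pi) ^ ((d : ℝ) / 2))⁻¹
    refine (memLp_congr_ae (Eventually.of_forall fun ξ => ?_)).1 this
    simp only [radialLift, norm_smul, norm_inv, Real.norm_of_nonneg h2π.le]
    rw [inv_mul_cancel_left₀ hp, mul_inv_cancel_left₀ h2π.ne']
  · intro h
    have := (memLp_comp_smul h h2π.ne').const_mul ((2 * Real.pi) ^ ((d : ℝ) / 2))
    refine (memLp_congr_ae (Eventually.of_forall fun ξ => ?_)).1 this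
    simp only [radialLift, norm_smul, Real.norm_of_nonneg h2π.le]

/-- Dominated convergence: at each `ξ` the truncation is eventually inactive. -/
lemma tendsto_truncatedLift (hβ : ContinuousOn β (Ici 0)) (hB : MemLp (radialLift d β) 2) :
    Tendsto (fun R => eLpNorm (truncatedLift d β R - radialLift d β) 2 volume) atTop (𝓝 0) := by
  have hBc := continuous_radialLift (d := d) hβ
  have h1 : Tendsto (fun R => ∫⁻ ξ, ‖(truncatedLift d β R - radialLift d β) ξ‖ₑ ^ (2 : ℝ)) atTop
      (𝓝 (∫⁻ _ : 𝔼, 0)) := by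
    refine tendsto_lintegral_filter_of_dominated_convergence
      (fun ξ => ‖radialLift d β ξ‖ₑ ^ (2 : ℝ)) ?_ ?_ ?_ ?_
    · refine Eventually.of_forall fun R => ?_
      have : Measurable (truncatedLift d β R) :=
        hBc.measurable.indicator (isCompact_norm_le R).measurableSet
      exact ((this.sub hBc.measurable).enorm).pow_const _
    · refine Eventually.of_forall fun R => Eventually.of_forall fun ξ => ?_
      by_cases h : 2 * Real.pi * ‖ξ‖ ≤ R <;> simp [truncatedLift, h]
    · have := hB.eLpNorm_lt_top
      rw [eLpNorm_lt_top_iff_lintegral_rpow_enorm_lt_top (by norm_num) (by norm_num)] at this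
      simpa using this.ne
    · refine Eventually.of_forall fun ξ => ?_
      refine tendsto_const_nhds.congr' ?_
      filter_upwards [eventually_ge_atTop (2 * Real.pi * ‖ξ‖)] with R hR
      simp [truncatedLift, hR]
  have h2 : ∀ R, eLpNorm (truncatedLift d β R - radialLift d β) 2 volume =
      (∫⁻ ξ, ‖(truncatedLift d β R - radialLift d β) ξ‖ₑ ^ (2 : ℝ)) ^ (1 / (2 : ℝ)) := by
    intro R
    rw [eLpNorm_eq_lintegral_rpow_enorm_toReal (by norm_num) (by norm_num)]
    simp
  simp only [h2]
  have := (ENNReal.continuous_rpow_const (y := 1 / (2 : ℝ))).tendsto 0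
  rw [lintegral_zero] at h1
  have h3 := this.comp h1
  rwa [ENNReal.zero_rpow_of_pos (by norm_num)] at h3

lemma cosTransform_eq_of_norm_eq (f : ℝ → ℝ) {ξ η : 𝔼} (h : ‖ξ‖ = ‖η‖) :
    cosTransform (fun x : 𝔼 => f ‖x‖) ξ = cosTransform (fun x : 𝔼 => f ‖x‖) η := by
  obtain ⟨A, rfl⟩ := exists_linearIsometryEquiv_apply_eq h
  rw [cosTransform, cosTransform,
    ← A.measurePreserving.integral_comp A.toHomeomorph.measurableEmbedding
      (fun x : 𝔼 => f ‖x‖ * Real.cos (2 * Real.pi * inner ℝ x (A ξ)))]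
  simp only [A.norm_map, A.inner_map_map]

end Hankel

/-! ### Plancherel for the Hankel transform and the characterization. -/

section Main

variable {d : ℕ} [NeZero d] {α β : ℝ → ℝ}

local notation "𝔼" => EuclideanSpace ℝ (Fin d)

/-- Passing from the half-line to `ℝ^d` multiplies every `L²` norm by the same finite nonzero
constant. -/
lemma isInverseHankelTransform_iff_tendsto (hα2 : MemLp α 2 (radialMeasure d))
    (hβ : ContinuousOn β (Ici 0)) :
    IsInverseHankelTransform d β α ↔
      Tendsto (fun R => eLpNorm (fun x : 𝔼 => cosTransform (truncatedLift d β R) x - α ‖x‖) 2 volume)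
        atTop (𝓝 0) := by
  set C : ℝ≥0∞ := (volume : Measure 𝔼).toSphere univ ^ (1 / (2 : ℝ≥0∞)).toReal
  have hC0 : C ≠ 0 := by
    have := toSphere_univ_ne_zero (d := d)
    simp only [C, ne_eq, ENNReal.rpow_eq_zero_iff, not_or, not_and]
    exact ⟨fun h => absurd h this, fun h => absurd h (measure_ne_top _ _)⟩
  have hCt : C ≠ ∞ := ENNReal.rpow_ne_top_of_nonneg ENNReal.toReal_nonneg (measure_ne_top _ _)
  have h1 : ∀ R, eLpNorm (fun x : 𝔼 => cosTransform (truncatedLift d β R) x - α ‖x‖) 2 volume =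
      C * eLpNorm (fun r => truncatedHankel d β R r - α r) 2 (radialMeasure d) := by
    intro R
    rw [← eLpNorm_comp_norm (p := 2) (f := fun r => truncatedHankel d β R r - α r) (by norm_num)
      ((aestronglyMeasurable_truncatedHankel hβ R).sub hα2.aestronglyMeasurable)]
    refine eLpNorm_congr_ae ?_
    filter_upwards [compl_mem_ae_iff.2 (measure_singleton (0 : 𝔼))] with x hx
    rw [cosTransform_truncatedLift hβ R hx]
  simp only [h1, IsInverseHankelTransform]
  constructor
  · intro h
    simpa using ENNReal.Tendsto.const_mul h (Or.inr hCt)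
  · intro h
    have := ENNReal.Tendsto.const_mul h (Or.inr (ENNReal.inv_ne_top.2 hC0))
    simpa [← mul_assoc, ENNReal.inv_mul_cancel hC0 hCt] using this

/-- The inverse Hankel transform expresses that `β` is a rescaling of the Fourier transform of the
radial function with profile `α`. -/
lemma isInverseHankelTransform_iff (hα1 : MemLp α 1 (radialMeasure d))
    (hα2 : MemLp α 2 (radialMeasure d)) (hβ : ContinuousOn β (Ici 0))
    (hβ2 : MemLp β 2 (radialMeasure d)) :
    IsInverseHankelTransform d β α ↔
      ∀ ξ : 𝔼, radialLift d β ξ = cosTransform (fun x : 𝔼 => α ‖x‖) ξ := by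
  set g : 𝔼 → ℝ := fun x => α ‖x‖
  have hg1 : Integrable g :=
    memLp_one_iff_integrable.1 ((memLp_comp_norm_iff hα1.aestronglyMeasurable).2 hα1)
  have hg2 : MemLp g 2 := (memLp_comp_norm_iff hα2.aestronglyMeasurable).2 hα2
  have hge : ∀ x, g (-x) = g x := fun x => by simp [g]
  have hB : MemLp (radialLift d β) 2 := (memLp_radialLift_iff hβ).2 hβ2
  have hBc : MemLp (fun ξ => (radialLift d β ξ : ℂ)) 2 volume := hB.ofReal (K := ℂ)
  have hgc : MemLp (fun x => (g x : ℂ)) 2 volume := hg2.ofReal (K := ℂ)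
  have hG1 : ∀ R, Integrable (fun ξ => (truncatedLift d β R ξ : ℂ)) :=
    fun R => (integrable_truncatedLift hβ R).ofReal
  have hG2 : ∀ R, MemLp (fun ξ => (truncatedLift d β R ξ : ℂ)) 2 volume :=
    fun R => (memLp_truncatedLift hβ R).ofReal (K := ℂ)
  set B : Lp ℂ 2 (volume : Measure 𝔼) := hBc.toLp _
  set γ : Lp ℂ 2 (volume : Measure 𝔼) := hgc.toLp _
  set G : ℝ → Lp ℂ 2 (volume : Measure 𝔼) := fun R => (hG2 R).toLp _
  have hreal : ∀ f : 𝔼 → ℝ, eLpNorm (fun x => (f x : ℂ)) 2 volume = eLpNorm f 2 volume :=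
    fun f => eLpNorm_congr_norm_ae (Eventually.of_forall fun x => by simp)
  have hGB : Tendsto G atTop (𝓝 B) := by
    rw [Lp.tendsto_Lp_iff_tendsto_eLpNorm'']
    refine (tendsto_truncatedLift hβ hB).congr fun R => ?_
    rw [← hreal]
    refine congrArg (fun f => eLpNorm f 2 volume) (funext fun x => ?_)
    simp
  -- By Plancherel the transforms of the truncations always converge to `𝓕 B`. Convergence to `α`
  -- therefore means `𝓕 B = γ`, that is, `B = 𝓕⁻ γ`.
  have hFG : Tendsto (fun R => (𝓕 (G R) : Lp ℂ 2 (volume : Measure 𝔼))) atTop (𝓝 (𝓕 B)) :=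
    ((Lp.fourierTransformₗᵢ 𝔼 ℂ).continuous.tendsto B).comp hGB
  have hiff : IsInverseHankelTransform d β α ↔
      Tendsto (fun R => (𝓕 (G R) : Lp ℂ 2 (volume : Measure 𝔼))) atTop (𝓝 γ) := by
    rw [isInverseHankelTransform_iff_tendsto hα2 hβ, Lp.tendsto_Lp_iff_tendsto_eLpNorm]
    refine tendsto_congr fun R => ?_
    rw [← hreal]
    refine eLpNorm_congr_ae ?_
    filter_upwards [fourier_toLp_ae_eq (hG1 R) (hG2 R)] with x hx
    rw [Pi.sub_apply, hx, fourier_ofReal_eq_cosTransform (integrable_truncatedLift hβ R)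
      (truncatedLift_neg R)]
    simp [g]
  have hiff2 : IsInverseHankelTransform d β α ↔ B = 𝓕⁻ γ := by
    rw [hiff]
    constructor
    · intro h
      rw [← tendsto_nhds_unique hFG h]
      exact (FourierTransform.fourierInv_fourier_eq B).symm
    · intro h
      have : 𝓕 B = γ := by rw [h]; exact FourierTransform.fourier_fourierInv_eq γ
      rwa [← this]
  have hγ : (𝓕⁻ γ : Lp ℂ 2 (volume : Measure 𝔼)) =ᵐ[volume] 𝓕 (fun x => (g x : ℂ)) :=
    fourierInv_toLp_ae_eq hg1.ofReal hgc (fun x => by rw [hge])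
  rw [hiff2]
  constructor
  · intro h
    have hae : radialLift d β =ᵐ[volume] cosTransform g := by
      have h1 : B =ᵐ[volume] _ := hBc.coeFn_toLp
      rw [h] at h1
      filter_upwards [h1, hγ] with ξ h2 h3
      rw [h3, fourier_ofReal_eq_cosTransform hg1 hge] at h2
      exact_mod_cast h2.symm
    -- Both sides are continuous, so equality almost everywhere is equality everywhere.
    exact congrFun ((Continuous.ae_eq_iff_eq volume (continuous_radialLift hβ)
      (continuous_cosTransform hg1)).1 hae)
  · intro h
    refine Lp.ext ?_
    filter_upwards [hBc.coeFn_toLp, hγ] with ξ h2 h3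
    rw [h2, h3, fourier_ofReal_eq_cosTransform hg1 hge, h]

lemma cosTransform_ball {a : ℝ} (ha : 0 ≤ a) (ξ : 𝔼) :
    cosTransform ((Metric.closedBall (0 : 𝔼) a).indicator 1) ξ =
      Real.pi ^ ((d : ℝ) / 2) * a ^ d * besselU ((d : ℝ) / 2) (a * (2 * Real.pi * ‖ξ‖)) := by
  have h := integral_ball_cos ha ((2 * Real.pi) • ξ)
  rw [norm_smul, Real.norm_of_nonneg (by positivity)] at h
  rw [← h, cosTransform]
  simp only [real_inner_smul_right]

/-- The zeros lie on countably many spheres about the origin. -/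
lemma ae_cosTransform_ball_ne_zero {a : ℝ} (ha : 0 < a) :
    ∀ᵐ ξ : 𝔼, cosTransform ((Metric.closedBall (0 : 𝔼) a).indicator 1) ξ ≠ 0 := by
  have hν : -1 / 2 ≤ (d : ℝ) / 2 := by have : (0 : ℝ) ≤ d := d.cast_nonneg
                                       linarith
  have hcount := countable_setOf_besselU_eq_zero hν (by positivity : 0 < a * (2 * Real.pi))
  set Z := {s : ℝ | 0 ≤ s ∧ besselU ((d : ℝ) / 2) (a * (2 * Real.pi) * s) = 0}
  have hZ : radialMeasure d Z = 0 :=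
    withDensity_absolutelyContinuous _ _ (Measure.absolutelyContinuous_of_le
      Measure.restrict_le_self (hcount.measure_zero volume))
  have h := quasiMeasurePreserving_norm.ae (measure_eq_zero_iff_ae_notMem.1 hZ)
  filter_upwards [h] with ξ hξ h0
  rw [cosTransform_ball ha.le] at h0
  have hp : Real.pi ^ ((d : ℝ) / 2) * a ^ d ≠ 0 :=
    mul_ne_zero (Real.rpow_pos_of_pos Real.pi_pos _).ne' (by positivity)
  refine hξ ⟨norm_nonneg _, ?_⟩
  rw [mul_assoc]
  exact (mul_eq_zero.1 h0).resolve_left hp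

/-- A radial profile generates an averaging kernel if and only if the product of its Fourier
transform with the normalized Bessel function is nonnegative. -/
lemma generatesRadialAveragingKernel_iff {a : ℝ} (ha : 0 < a) (hα1 : MemLp α 1 (radialMeasure d))
    (hα2 : MemLp α 2 (radialMeasure d)) :
    GeneratesRadialAveragingKernel d a α ↔
      ∀ ξ : 𝔼, 0 ≤ cosTransform (fun x : 𝔼 => α ‖x‖) ξ *
        besselU ((d : ℝ) / 2) (a * (2 * Real.pi * ‖ξ‖)) := by
  have hg1 : Integrable fun x : 𝔼 => α ‖x‖ :=
    memLp_one_iff_integrable.1 ((memLp_comp_norm_iff hα1.aestronglyMeasurable).2 hα1)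
  have hg2 : MemLp (fun x : 𝔼 => α ‖x‖) 2 :=
    (memLp_comp_norm_iff hα2.aestronglyMeasurable).2 hα2
  have hge : ∀ x : 𝔼, α ‖-x‖ = α ‖x‖ := fun x => by rw [norm_neg]
  have hp : 0 < Real.pi ^ ((d : ℝ) / 2) * a ^ d :=
    mul_pos (Real.rpow_pos_of_pos Real.pi_pos _) (by positivity)
  constructor
  · intro h ξ
    have := cosTransform_mul_nonneg_of_isUniformAveragingKernel (g := fun x : 𝔼 => α ‖x‖) ha hg1
      hg2 hge h ξ
    rw [cosTransform_ball ha.le, mul_left_comm] at this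
    exact nonneg_of_mul_nonneg_right this hp
  · intro h
    refine isUniformAveragingKernel_of_cosTransform_mul_nonneg (g := fun x : 𝔼 => α ‖x‖) ha hg1
      hg2 hge (fun ξ => ?_) (ae_cosTransform_ball_ne_zero ha)
    rw [cosTransform_ball ha.le, mul_left_comm]
    exact mul_nonneg hp.le (h ξ)

end Main

theorem mainTheorem3 (d : ℕ) (hd : 1 ≤ d) (a : ℝ) (ha : 0 < a) (α : ℝ → ℝ)
    (hα1 : MemLp α 1 (radialMeasure d)) (hα2 : MemLp α 2 (radialMeasure d))
    (hα0 : ¬ α =ᵐ[radialMeasure d] 0) :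
    GeneratesRadialAveragingKernel d a α ↔
      ∃ β : ℝ → ℝ, ContinuousOn β (Ici 0) ∧ Tendsto β atTop (𝓝 0) ∧
        MemLp β 2 (radialMeasure d) ∧ IsInverseHankelTransform d β α ∧
        HasBesselSignPattern d a β := by
  have : NeZero d := ⟨by omega⟩
  have h2π : 0 < 2 * Real.pi := by positivity
  have hp : 0 < (2 * Real.pi) ^ ((d : ℝ) / 2) := Real.rpow_pos_of_pos h2π _
  set g : EuclideanSpace ℝ (Fin d) → ℝ := fun x => α ‖x‖
  have hg1 : Integrable g :=
    memLp_one_iff_integrable.1 ((memLp_comp_norm_iff hα1.aestronglyMeasurable).2 hα1)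
  have hg2 : MemLp g 2 := (memLp_comp_norm_iff hα2.aestronglyMeasurable).2 hα2
  have hge : ∀ x, g (-x) = g x := fun x => by simp [g]
  rw [generatesRadialAveragingKernel_iff ha hα1 hα2]
  let ray : ℝ → EuclideanSpace ℝ (Fin d) := fun s =>
    ((2 * Real.pi)⁻¹ * s) • EuclideanSpace.single (0 : Fin d) (1 : ℝ)
  have hray : ∀ s, 0 ≤ s → ‖ray s‖ = (2 * Real.pi)⁻¹ * s := by
    intro s hs
    simp only [ray, norm_smul, PiLp.norm_single, norm_one, mul_one]
    exact Real.norm_of_nonneg (by positivity)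
  have hrayc : Continuous ray := by fun_prop
  constructor
  · intro hpos
    -- This choice is forced by `radialLift d β = cosTransform g`, read along a ray on which `‖ray
    -- s‖ = s/(2π)`.
    let β : ℝ → ℝ := fun s => ((2 * Real.pi) ^ ((d : ℝ) / 2))⁻¹ * cosTransform g (ray s)
    have hβc : Continuous β := continuous_const.mul ((continuous_cosTransform hg1).comp hrayc)
    have hlift : ∀ ξ, radialLift d β ξ = cosTransform g ξ := by
      intro ξ
      simp only [radialLift, β]
      rw [mul_inv_cancel_left₀ hp.ne']
      refine cosTransform_eq_of_norm_eq α ?_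
      rw [hray _ (by positivity), inv_mul_cancel_left₀ h2π.ne']
    have hβ2 : MemLp β 2 (radialMeasure d) := by
      rw [← memLp_radialLift_iff hβc.continuousOn]
      exact (memLp_congr_ae (Eventually.of_forall hlift)).2 (memLp_cosTransform hg1 hg2 hge)
    refine ⟨β, hβc.continuousOn, ?_, hβ2, ?_, ?_⟩
    · have h1 : Tendsto ray atTop (cocompact _) := by
        rw [← Metric.cobounded_eq_cocompact, ← tendsto_norm_atTop_iff_cobounded]
        refine (tendsto_id.const_mul_atTop (inv_pos.2 h2π)).congr' ?_
        filter_upwards [eventually_ge_atTop 0] with s hs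
        exact (hray s hs).symm
      have := ((tendsto_cosTransform_cocompact hg1 hge).comp h1).const_mul
        ((2 * Real.pi) ^ ((d : ℝ) / 2))⁻¹
      simpa using this
    · exact (isInverseHankelTransform_iff hα1 hα2 hβc.continuousOn hβ2).2 hlift
    · rw [hasBesselSignPattern_iff ha hβc.continuousOn]
      intro s hs
      have := hpos (ray s)
      rw [hray s hs, mul_inv_cancel_left₀ h2π.ne'] at this
      simp only [β]
      rw [mul_assoc]
      exact mul_nonneg (by positivity) this
  · rintro ⟨β, hβ, -, hβ2, hH, hS⟩ ξ
    have hlift := (isInverseHankelTransform_iff hα1 hα2 hβ hβ2).1 hH ξ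
    rw [hasBesselSignPattern_iff ha hβ] at hS
    have := hS (2 * Real.pi * ‖ξ‖) (by positivity)
    rw [← hlift, radialLift, mul_assoc]
    exact mul_nonneg hp.le this
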